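/- Fourier transforms are normalized by $\widehat f(\xi)=\int_{\mathbb R}e^{-ix\xi}f(x)\,dx$. Let $\mathcal W$ be a real-valued even tempered distribution on $\mathbb R$ with $\widehat{\mathcal W}\in L^\infty(\mathbb R)$. Let $$\mathcal E(\mathbb R)=\{v\in H^1_{\mathrm{loc}}(\mathbb R;\mathbb C): 1-|v|^2\in L^2(\mathbb R),\ v'\in L^2(\mathbb R;\mathbb C)\}.$$ Let $c\ge 0$ and let $u\in\mathcal E(\mathbb R)$ be a solution, in the sense of distributions, of the traveling-wave equation $$icu'+u''+u\,\bigl(\mathcal W*(1-|u|^2)\bigr)=0\quad\text{in }\mathbb R.$$ Suppose that $M_c(\xi)=\xi^2+2\widehat{\mathcal W}(\xi)-c^2$ is nonzero for a.e. $\xi\in\mathbb R$, that $\mathcal L_c$ is a tempered distribution with $\widehat{\mathcal L_c}=1/M_c$, and that $\mathcal L_c$ is a function with $e^{m|\cdot|}\mathcal L_c\in L^p(\mathbb R)$ for some $m>0$ and some $p\in(1,\infty]$. Then $u$ coincides almost everywhere with a function of class $C^\infty(\mathbb R)$, and, $u$ being identified with this function, $\eta=1-|u|^2$ satisfies $$\lim_{|x|\to\infty}e^{\ell|x|}D^k\eta(x)=0\qquad\text{for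 all }\ell\in[0,m)\text{ and all }k\in\mathbb N,\ k\ge 0.$$ -/

import Mathlib

open MeasureTheory Filter Topology
open scoped ENNReal ContDiff SchwartzMap FourierTransform

noncomputable section

namespace NonlocalGP

/-- Smooth compactly supported complex-valued test functions on the line. -/
def IsTestFunction (φ : ℝ → ℂ) : Prop :=
  ContDiff ℝ ∞ φ ∧ HasCompactSupport φ

/-- `u ∈ L²_loc(ℝ; ℂ)`. -/
def IsLocallyL2 (u : ℝ → ℂ) : Prop :=
  ∀ K : Set ℝ, IsCompact K → MemLp u 2 (volume.restrict K)

/-- `v` is the weak (distributional) derivative of `u`, both being locally integrable. -/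
def HasWeakDeriv (u v : ℝ → ℂ) : Prop :=
  LocallyIntegrable u ∧ LocallyIntegrable v ∧
    ∀ φ : ℝ → ℂ, IsTestFunction φ → ∫ x, u x * deriv φ x = - ∫ x, v x * φ x

/-- The density `η = 1 - |u|²`. -/
def eta (u : ℝ → ℂ) (x : ℝ) : ℝ := 1 - ‖u x‖ ^ 2

/-- The energy space: `u ∈ H¹_loc(ℝ; ℂ)` with `1 - |u|² ∈ L²(ℝ)` and `u' ∈ L²(ℝ; ℂ)`. -/
def InEnergySpace (u : ℝ → ℂ) : Prop :=
  IsLocallyL2 u ∧ MemLp (eta u) 2 ∧ ∃ v : ℝ → ℂ, HasWeakDeriv u v ∧ MemLp v 2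

/-- The dilation `x ↦ x / (2π)` of the line. -/
def angDilation : ℝ ≃L[ℝ] ℝ :=
  ContinuousLinearEquiv.unitsEquivAut ℝ (Units.mk0 (2 * Real.pi)⁻¹ (by positivity))

/-- The Fourier transform `φ̂(ξ) = ∫ e^{-ixξ} φ(x) dx` of a Schwartz function
(see `angFourier_apply`). -/
def angFourier (φ : 𝓢(ℝ, ℂ)) : 𝓢(ℝ, ℂ) :=
  SchwartzMap.compCLMOfContinuousLinearEquiv ℂ angDilation (𝓕 φ)

theorem angFourier_apply (φ : 𝓢(ℝ, ℂ)) (ξ : ℝ) :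
    angFourier φ ξ = ∫ x : ℝ, Complex.exp (-(Complex.I * x * ξ)) * φ x := by
  have h : angDilation ξ = ξ * (2 * Real.pi)⁻¹ := by
    simp [angDilation, ContinuousLinearEquiv.unitsEquivAut]
  change (𝓕 φ) (angDilation ξ) = _
  rw [h, SchwartzMap.fourier_coe, Real.fourier_real_eq_integral_exp_smul]
  refine integral_congr_ae (Eventually.of_forall fun x => ?_)
  simp only [smul_eq_mul]
  congr 2
  push_cast
  have hpi : (Real.pi : ℂ) ≠ 0 := by exact_mod_cast Real.pi_ne_zero
  field_simp

/-- The tempered distribution `T` is (integration against) the function `f`. -/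
def IsFunction (T : 𝓢'(ℝ, ℂ)) (f : ℝ → ℂ) : Prop :=
  ∀ φ : 𝓢(ℝ, ℂ), Integrable (fun x => f x * φ x) ∧ T φ = ∫ x, f x * φ x

/-- The Fourier transform `T̂` of the tempered distribution `T`, given by `⟨T̂, φ⟩ = ⟨T, φ̂⟩`,
is (integration against) the function `g`. -/
def HasFourierTransform (T : 𝓢'(ℝ, ℂ)) (g : ℝ → ℂ) : Prop :=
  ∀ φ : 𝓢(ℝ, ℂ), Integrable (fun ξ => g ξ * φ ξ) ∧ T (angFourier φ) = ∫ ξ, g ξ * φ ξ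

/-- `T` is real-valued: it takes real values on real-valued Schwartz functions. -/
def IsRealValued (T : 𝓢'(ℝ, ℂ)) : Prop :=
  ∀ φ : 𝓢(ℝ, ℂ), (∀ x, (φ x).im = 0) → (T φ).im = 0

/-- `T` is even: it is invariant under `x ↦ -x`. -/
def IsEven (T : 𝓢'(ℝ, ℂ)) : Prop :=
  ∀ φ : 𝓢(ℝ, ℂ),
    T (SchwartzMap.compCLMOfContinuousLinearEquiv ℂ (ContinuousLinearEquiv.neg ℝ) φ) = T φ

/-- Admissible potentials: real-valued even tempered distributions whose Fourier transform is an
essentially bounded function. -/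
def IsPotential (W : 𝓢'(ℝ, ℂ)) : Prop :=
  IsRealValued W ∧ IsEven W ∧ ∃ w : ℝ → ℂ, HasFourierTransform W w ∧ MemLp w ∞

/-- `g = W * f` in `L²(ℝ)`, in the sense of the convolution of distributions:
`⟨W * f, φ⟩ = ∫ f(x) ⟨W, φ(x + ·)⟩ dx` for all Schwartz functions `φ`. -/
def IsConvolution (W : 𝓢'(ℝ, ℂ)) (f g : ℝ → ℂ) : Prop :=
  MemLp f 2 ∧ MemLp g 2 ∧ ∀ φ : 𝓢(ℝ, ℂ),
    Integrable (fun x => f x * W (SchwartzMap.compSubConstCLM ℂ (-x) φ)) ∧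
    ∫ x, g x * φ x = ∫ x, f x * W (SchwartzMap.compSubConstCLM ℂ (-x) φ)

/-- `u` solves `i c u' + u'' + u (W * (1 - |u|²)) = 0` on `ℝ` in the sense of distributions. -/
def IsTravelingWave (W : 𝓢'(ℝ, ℂ)) (c : ℝ) (u : ℝ → ℂ) : Prop :=
  ∃ g : ℝ → ℂ, IsConvolution W (fun x => (eta u x : ℂ)) g ∧
    ∀ φ : ℝ → ℂ, IsTestFunction φ →
      ∫ x, (-(Complex.I * c * u x * deriv φ x) + u x * iteratedDeriv 2 φ x
        + u x * g x * φ x) = 0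

/-- The symbol `M_c(ξ) = ξ² + 2 Ŵ(ξ) - c²`, where `w = Ŵ`. -/
def symbol (w : ℝ → ℂ) (c ξ : ℝ) : ℂ := (ξ : ℂ) ^ 2 + 2 * w ξ - (c : ℂ) ^ 2

/-- `L` is the tempered distribution `𝓛_c` with Fourier transform `1 / M_c`. The symbol is
required to be nonzero almost everywhere, so that `1 / M_c` is meaningful. -/
def IsKernel (W : 𝓢'(ℝ, ℂ)) (c : ℝ) (L : 𝓢'(ℝ, ℂ)) : Prop :=
  ∃ w : ℝ → ℂ, HasFourierTransform W w ∧ (∀ᵐ ξ : ℝ, symbol w c ξ ≠ 0) ∧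
    HasFourierTransform L (fun ξ => 1 / symbol w c ξ)

end NonlocalGP

end

/-!
Finite energy traveling waves are smooth and their density `η = 1 - |u|²` decays as fast as the
kernel `𝓛_c`.

**Smoothness.** Convolution with `W` is multiplication by the bounded function `Ŵ` on the Fourier
side, hence preserves the number of square integrable derivatives
(`IsConvolution.isFourierPair`, `IsConvolution.exists_reg`). The equation first shows that `u`, which
is bounded by `bounded_of_memLp_eta`, has a `C¹` representative (`exists_C1_representative`); after
that each derivative of `η` in `L²` passes to `W * η`, and the equation returns one more derivative
of `u`. This gives `exists_isSmoothWave`: all derivatives of `η`, `u'` and `W * η` are in `L²`, so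
they are bounded and vanish at infinity.

**The equation for the density.** Since `W * η` is real, the momentum `Im (ū u')` differs from
`c η / 2` by a constant, which vanishes by integrability (`IsSmoothWave.momentum`). It follows that
`-η'' - c² η + 2 W * η = F` with `F = 2 |u'|² + 2 η (W * η)` (`IsSmoothWave.source_eq`), that is
`M_c η̂ = F̂`. Inverting the symbol yields `η = 𝓛_c * F` and `η' = 𝓛_c * F'`
(`IsSmoothWave.eta_eq_integral`, `IsSmoothWave.deriv_eta_eq_integral`).

**Decay.** The source is quadratic, and `2 ū u' = -η' + i c η` bounds `u'` by `η` and `η'` where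
`|u|` is close to one; so `|F| + |F'|` is negligible with respect to `|η| + |η'|` at infinity
(`IsSmoothWave.eventually_source_le`). For every `a < m` the weight `e^{a|x|}` can therefore be
absorbed in the convolution equation (`expDecay_of_le_integral`), using only that `e^{a|·|} 𝓛_c` is
integrable. No decay of `W` itself is needed. The derivatives are treated by interpolation: they
are bounded, and the Landau–Kolmogorov inequality, used repeatedly, transfers to `η'` any
exponential rate smaller than that of `η` (`SmoothBounded.expDecay_deriv`).
-/

namespace NonlocalGP

/-! ### The Fourier transform on `L²` by duality with Schwartz functions -/

/-- `h ∈ L²` is the Fourier transform of `f ∈ L²`, in Mathlib's normalization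
`∫ e^{-2πixξ} f(x) dx`: this is expressed by duality against Schwartz functions, so that it makes
sense for functions defined only almost everywhere. -/
structure IsFourierPair (f h : ℝ → ℂ) : Prop where
  left : MemLp f 2
  right : MemLp h 2
  pair : ∀ ψ : 𝓢(ℝ, ℂ), ∫ x, f x * (𝓕 ψ) x = ∫ x, h x * ψ x

theorem integrable_mul_of_memLp_two {f g : ℝ → ℂ} (hf : MemLp f 2) (hg : MemLp g 2) :
    Integrable (fun x => f x * g x) :=
  hf.integrable_mul hg

theorem integral_mul_congr_right {f g g' : ℝ → ℂ} (h : g =ᵐ[volume] g') :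
    ∫ x, f x * g x = ∫ x, f x * g' x :=
  integral_congr_ae (h.mono fun x hx => congrArg (f x * ·) hx)

theorem integral_mul_fourier {f g : ℝ → ℂ} (hf : Integrable f) (hg : Integrable g) :
    ∫ x, f x * 𝓕 g x = ∫ x, 𝓕 f x * g x := by
  have h := VectorFourier.integral_fourierIntegral_smul_eq_flip (L := innerₗ ℝ)
    Real.continuous_fourierChar continuous_inner hf hg
  rw [flip_innerₗ] at h
  exact h.symm

theorem continuous_fourier {f : ℝ → ℂ} (hf : Integrable f) : Continuous (𝓕 f) :=
  VectorFourier.fourierIntegral_continuous Real.continuous_fourierChar continuous_inner hf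

theorem continuous_fourierInv {f : ℝ → ℂ} (hf : Integrable f) : Continuous (𝓕⁻ f) := by
  rw [Real.fourierInv_eq_fourier_comp_neg]
  exact continuous_fourier hf.comp_neg

/-- Locally integrable functions are determined almost everywhere by Schwartz test functions. -/
theorem ae_eq_of_integral_mul_schwartz_eq {f g : ℝ → ℂ} (hf : LocallyIntegrable f)
    (hg : LocallyIntegrable g) (h : ∀ φ : 𝓢(ℝ, ℂ), ∫ x, f x * φ x = ∫ x, g x * φ x) :
    f =ᵐ[volume] g := by
  refine ae_eq_of_integral_contDiff_smul_eq hf hg fun φ hφ hφc => ?_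
  have hc : HasCompactSupport (fun x => (φ x : ℂ)) := hφc.comp_left (g := ((↑) : ℝ → ℂ)) rfl
  have hs : ContDiff ℝ ∞ (fun x => (φ x : ℂ)) := Complex.ofRealCLM.contDiff.comp hφ
  have := h (hc.toSchwartzMap hs)
  simpa [HasCompactSupport.toSchwartzMap_toFun, mul_comm] using this

theorem locallyIntegrable_of_memLp_two {f : ℝ → ℂ} (hf : MemLp f 2) : LocallyIntegrable f :=
  hf.locallyIntegrable (by norm_num)

namespace IsFourierPair

theorem of_Lp (f : Lp ℂ 2 (volume : Measure ℝ)) :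
    IsFourierPair f (𝓕 f : Lp ℂ 2 (volume : Measure ℝ)) where
  left := Lp.memLp f
  right := Lp.memLp _
  pair ψ := by
    have h := congrArg (fun T : 𝓢'(ℝ, ℂ) => T ψ) (Lp.fourier_toTemperedDistribution_eq f)
    simpa [TemperedDistribution.fourier_apply, Lp.toTemperedDistribution_apply, mul_comm]
      using h

theorem congr {f f' h h' : ℝ → ℂ} (H : IsFourierPair f h) (hf : f =ᵐ[volume] f')
    (hh : h =ᵐ[volume] h') : IsFourierPair f' h' where
  left := H.left.ae_eq hf
  right := H.right.ae_eq hh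
  pair ψ := by
    rw [← integral_congr_ae (hf.mono fun x hx => show f x * (𝓕 ψ) x = f' x * (𝓕 ψ) x by rw [hx]),
      H.pair, integral_congr_ae (hh.mono fun x hx => show h x * ψ x = h' x * ψ x by rw [hx])]

theorem exists_right {f : ℝ → ℂ} (hf : MemLp f 2) : ∃ h, IsFourierPair f h :=
  ⟨_, (of_Lp hf.toLp).congr hf.coeFn_toLp (ae_eq_refl _)⟩

theorem exists_left {h : ℝ → ℂ} (hh : MemLp h 2) : ∃ f, IsFourierPair f h := by
  have := of_Lp (𝓕⁻ hh.toLp : Lp ℂ 2 (volume : Measure ℝ))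
  rw [FourierTransform.fourier_fourierInv_eq] at this
  exact ⟨_, this.congr (ae_eq_refl _) hh.coeFn_toLp⟩

theorem right_ae_eq {f h h' : ℝ → ℂ} (H : IsFourierPair f h) (H' : IsFourierPair f h') :
    h =ᵐ[volume] h' :=
  ae_eq_of_integral_mul_schwartz_eq (locallyIntegrable_of_memLp_two H.right)
    (locallyIntegrable_of_memLp_two H'.right) fun φ => by rw [← H.pair, H'.pair]

/-- A locally integrable function whose pairings with Fourier transforms of Schwartz functions are
those of `f` agrees with `f`. -/
theorem left_ae_eq_of_integral {f f' h : ℝ → ℂ} (H : IsFourierPair f h) (hf' : LocallyIntegrable f')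
    (H' : ∀ ψ : 𝓢(ℝ, ℂ), ∫ x, f' x * (𝓕 ψ) x = ∫ x, h x * ψ x) :
    f =ᵐ[volume] f' :=
  ae_eq_of_integral_mul_schwartz_eq (locallyIntegrable_of_memLp_two H.left) hf' fun φ => by
    have h1 := H.pair (𝓕⁻ φ)
    have h2 := H' (𝓕⁻ φ)
    rw [FourierTransform.fourier_fourierInv_eq] at h1 h2
    rw [h1, h2]

theorem left_ae_eq {f f' h : ℝ → ℂ} (H : IsFourierPair f h) (H' : IsFourierPair f' h) :
    f =ᵐ[volume] f' :=
  H.left_ae_eq_of_integral (locallyIntegrable_of_memLp_two H'.left) H'.pair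

theorem right_ae_eq_of_integral {f h h' : ℝ → ℂ} (H : IsFourierPair f h)
    (hh' : LocallyIntegrable h') (H' : ∀ ψ : 𝓢(ℝ, ℂ), ∫ x, f x * (𝓕 ψ) x = ∫ x, h' x * ψ x) :
    h =ᵐ[volume] h' :=
  ae_eq_of_integral_mul_schwartz_eq (locallyIntegrable_of_memLp_two H.right) hh' fun φ => by
    rw [← H.pair, H']

theorem add {f g h k : ℝ → ℂ} (H : IsFourierPair f h) (K : IsFourierPair g k) :
    IsFourierPair (fun x => f x + g x) (fun x => h x + k x) where
  left := H.left.add K.left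
  right := H.right.add K.right
  pair ψ := by
    simp only [add_mul]
    rw [integral_add (integrable_mul_of_memLp_two H.left ((𝓕 ψ : 𝓢(ℝ, ℂ)).memLp 2))
      (integrable_mul_of_memLp_two K.left ((𝓕 ψ : 𝓢(ℝ, ℂ)).memLp 2)),
      integral_add (integrable_mul_of_memLp_two H.right (ψ.memLp 2))
      (integrable_mul_of_memLp_two K.right (ψ.memLp 2)), H.pair, K.pair]

theorem const_mul {f h : ℝ → ℂ} (H : IsFourierPair f h) (a : ℂ) :
    IsFourierPair (fun x => a * f x) (fun x => a * h x) where
  left := H.left.const_mul a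
  right := H.right.const_mul a
  pair ψ := by
    simp only [mul_assoc, integral_const_mul, H.pair]

/-- For an integrable `h ∈ L²` the `L²` inverse Fourier transform is given by the integral. -/
theorem fourierInv {h : ℝ → ℂ} (hh : MemLp h 2) (hi : Integrable h) :
    IsFourierPair (𝓕⁻ h) h := by
  obtain ⟨f, H⟩ := exists_left hh
  refine H.congr (H.left_ae_eq_of_integral
    (continuous_fourierInv hi).locallyIntegrable fun ψ => ?_) (ae_eq_refl _)
  have h1 : ∀ x, (𝓕⁻ h) x = 𝓕 h (-x) := fun x => Real.fourierInv_eq_fourier_neg h x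
  have h2 : ∀ x : ℝ, (𝓕 ψ) (-x) = (𝓕⁻ ψ) x := fun x => by
    rw [SchwartzMap.fourierInv_coe, SchwartzMap.fourier_coe, Real.fourierInv_eq_fourier_neg]
  calc ∫ x, (𝓕⁻ h) x * (𝓕 ψ) x = ∫ x, 𝓕 h (-x) * (𝓕 ψ) x := by simp only [h1]
    _ = ∫ x, 𝓕 h x * (𝓕 ψ) (-x) := by
        rw [← integral_neg_eq_self]; simp
    _ = ∫ x, 𝓕 h x * (𝓕⁻ ψ) x := by simp only [h2]
    _ = ∫ x, h x * 𝓕 (𝓕⁻ ψ : 𝓢(ℝ, ℂ)) x := (integral_mul_fourier hi (𝓕⁻ ψ).integrable).symm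
    _ = ∫ x, h x * (𝓕 (𝓕⁻ ψ) : 𝓢(ℝ, ℂ)) x := rfl
    _ = ∫ x, h x * ψ x := by rw [FourierTransform.fourier_fourierInv_eq]

/-- For an integrable `f ∈ L²` the `L²` Fourier transform is given by the integral. -/
theorem fourier {f : ℝ → ℂ} (hf : MemLp f 2) (hi : Integrable f) :
    IsFourierPair f (𝓕 f) := by
  obtain ⟨h, H⟩ := exists_right hf
  exact H.congr (ae_eq_refl _) (H.right_ae_eq_of_integral
    (continuous_fourier hi).locallyIntegrable fun ψ => integral_mul_fourier hi ψ.integrable)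

/-- The duality relation extends from Schwartz functions to `L²`. -/
theorem integral_mul {f h a b : ℝ → ℂ} (H : IsFourierPair f h) (K : IsFourierPair a b) :
    ∫ x, f x * b x = ∫ x, h x * a x := by
  have key : ∀ (g : ℝ → ℂ) (hg : MemLp g 2),
      Continuous fun q : Lp ℂ 2 (volume : Measure ℝ) => ∫ x, g x * q x := by
    intro g hg
    have hc : MemLp (fun x => (starRingEnd ℂ) (g x)) 2 := hg.star
    have : (fun q : Lp ℂ 2 (volume : Measure ℝ) => ∫ x, g x * q x) =
        fun q => inner ℂ hc.toLp q := by
      ext q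
      rw [L2.inner_def]
      refine integral_congr_ae ?_
      filter_upwards [hc.coeFn_toLp] with x hx
      rw [hx]
      simp [mul_comm]
    rw [this]
    fun_prop
  -- Both sides are continuous in `q ∈ L²` and agree on the dense set of Schwartz functions.
  have main : ∀ q : Lp ℂ 2 (volume : Measure ℝ),
      ∫ x, f x * (𝓕 q : Lp ℂ 2 (volume : Measure ℝ)) x = ∫ x, h x * q x := by
    have hdense : DenseRange (SchwartzMap.toLpCLM ℝ ℂ 2 (volume : Measure ℝ)) :=
      SchwartzMap.denseRange_toLpCLM ENNReal.ofNat_ne_top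
    have hF : Continuous (fun q : Lp ℂ 2 (volume : Measure ℝ) =>
        (𝓕 q : Lp ℂ 2 (volume : Measure ℝ))) := (Lp.fourierTransformₗᵢ ℝ ℂ).continuous
    have hS : ∀ ψ : 𝓢(ℝ, ℂ), ∫ x, f x * (𝓕 (ψ.toLp 2) : Lp ℂ 2 (volume : Measure ℝ)) x =
        ∫ x, h x * (ψ.toLp 2) x := by
      intro ψ
      rw [SchwartzMap.toLp_fourier_eq]
      exact (integral_mul_congr_right ((𝓕 ψ).coeFn_toLp 2)).trans
        ((H.pair ψ).trans (integral_mul_congr_right (ψ.coeFn_toLp 2)).symm)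
    intro q
    refine hdense.induction_on q (isClosed_eq ((key f H.left).comp hF) (key h H.right)) hS
  have h1 := main K.left.toLp
  have h2 : ((𝓕 K.left.toLp : Lp ℂ 2 (volume : Measure ℝ)) : ℝ → ℂ) =ᵐ[volume] b :=
    ((of_Lp K.left.toLp).congr K.left.coeFn_toLp (ae_eq_refl _)).right_ae_eq K
  exact (integral_mul_congr_right h2).symm.trans
    (h1.trans (integral_mul_congr_right K.left.coeFn_toLp))

theorem hasTemperateGrowth_const_mul_ofReal (a : ℂ) :
    (fun x : ℝ => a * (x : ℂ)).HasTemperateGrowth := by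
  have : (fun x : ℝ => (x : ℂ)).HasTemperateGrowth := Complex.ofRealCLM.hasTemperateGrowth
  fun_prop

/-- Differentiation becomes multiplication by `2πiξ`. -/
theorem deriv {f h : ℝ → ℂ} (H : IsFourierPair f h) (hd : Differentiable ℝ f)
    (hf' : MemLp (deriv f) 2) :
    IsFourierPair (deriv f) (fun ξ : ℝ => (2 * Real.pi * Complex.I * ξ) * h ξ) := by
  obtain ⟨k, K⟩ := exists_right hf'
  have hloc : LocallyIntegrable (fun ξ : ℝ => (2 * Real.pi * Complex.I * ξ) * h ξ) :=
    (locallyIntegrable_of_memLp_two H.right).continuous_mul (by fun_prop)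
  refine K.congr (ae_eq_refl _) (K.right_ae_eq_of_integral hloc fun ψ => ?_)
  set χ : 𝓢(ℝ, ℂ) :=
    SchwartzMap.smulLeftCLM ℂ (fun x : ℝ => (-2 * Real.pi * Complex.I) * (x : ℂ)) ψ with hχ
  have hχx : ∀ x, χ x = (-2 * Real.pi * Complex.I) * (x : ℂ) * ψ x := fun x => by
    rw [hχ, SchwartzMap.smulLeftCLM_apply_apply (hasTemperateGrowth_const_mul_ofReal _)]
    simp
  have hFd : ∀ x, HasDerivAt (𝓕 ψ : 𝓢(ℝ, ℂ)) ((𝓕 χ : 𝓢(ℝ, ℂ)) x) x := by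
    intro x
    have hint : Integrable fun x : ℝ => x • ψ x := by
      have h0 : Integrable χ := χ.integrable
      have h1 := h0.const_mul ((-2 * Real.pi * Complex.I)⁻¹)
      refine h1.congr (Eventually.of_forall fun x => ?_)
      have hpi : (Real.pi : ℂ) ≠ 0 := by exact_mod_cast Real.pi_ne_zero
      simp only [hχx, Complex.real_smul]
      field_simp [Complex.I_ne_zero]
    have := Real.hasDerivAt_fourier ψ.integrable hint x
    have hχ' : (fun x : ℝ => (-2 * Real.pi * Complex.I * x) • ψ x) = χ := by
      ext x
      rw [hχx, smul_eq_mul]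
    rw [hχ'] at this
    exact this
  have hparts := integral_mul_deriv_eq_deriv_mul_of_integrable (u := f) (v := (𝓕 ψ : 𝓢(ℝ, ℂ)))
    (u' := _root_.deriv f) (v' := (𝓕 χ : 𝓢(ℝ, ℂ))) (fun x _ => (hd x).hasDerivAt) (fun x _ => hFd x)
    (integrable_mul_of_memLp_two H.left ((𝓕 χ : 𝓢(ℝ, ℂ)).memLp 2))
    (integrable_mul_of_memLp_two hf' ((𝓕 ψ : 𝓢(ℝ, ℂ)).memLp 2))
    (integrable_mul_of_memLp_two H.left ((𝓕 ψ : 𝓢(ℝ, ℂ)).memLp 2))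
  rw [H.pair] at hparts
  rw [← neg_eq_iff_eq_neg] at hparts
  rw [← hparts, ← integral_neg]
  refine integral_congr_ae (Eventually.of_forall fun x => ?_)
  simp only [hχx]
  ring

end IsFourierPair

/-! ### Functions with derivatives in `L²` or in `L^∞` -/

/-- `Reg p n f` says that `f` is of class `C^n` and that its derivatives of order `0, …, n` belong
to `L^p`. -/
def Reg (p : ℝ≥0∞) : ℕ → (ℝ → ℂ) → Prop
  | 0, f => Continuous f ∧ MemLp f p
  | n + 1, f => Differentiable ℝ f ∧ MemLp f p ∧ Reg p n (deriv f)

namespace Reg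

variable {p : ℝ≥0∞} {n : ℕ} {f g : ℝ → ℂ}

theorem continuous (h : Reg p n f) : Continuous f := by
  cases n with
  | zero => exact h.1
  | succ n => exact h.1.continuous

theorem memLp (h : Reg p n f) : MemLp f p := by
  cases n with
  | zero => exact h.2
  | succ n => exact h.2.1

theorem of_succ (h : Reg p (n + 1) f) : Reg p n f := by
  induction n generalizing f with
  | zero => exact ⟨h.continuous, h.memLp⟩
  | succ n ih => exact ⟨h.1, h.memLp, ih h.2.2⟩

theorem contDiff (h : Reg p n f) : ContDiff ℝ n f := by
  induction n generalizing f with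
  | zero => exact_mod_cast contDiff_zero.2 h.1
  | succ n ih =>
    have : ContDiff ℝ ((n : ℕ∞ω) + 1) f :=
      contDiff_succ_iff_deriv.2 ⟨h.1, by simp, ih h.2.2⟩
    exact_mod_cast this

theorem add (hf : Reg p n f) (hg : Reg p n g) : Reg p n (fun x => f x + g x) := by
  induction n generalizing f g with
  | zero => exact ⟨hf.1.add hg.1, hf.2.add hg.2⟩
  | succ n ih =>
    refine ⟨hf.1.add hg.1, hf.2.1.add hg.2.1, ?_⟩
    have : deriv (fun x => f x + g x) = fun x => deriv f x + deriv g x :=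
      funext fun x => deriv_fun_add (hf.1 x) (hg.1 x)
    rw [this]
    exact ih hf.2.2 hg.2.2

theorem const_mul (hf : Reg p n f) (a : ℂ) : Reg p n (fun x => a * f x) := by
  induction n generalizing f with
  | zero => exact ⟨hf.1.const_mul a, hf.2.const_mul a⟩
  | succ n ih =>
    refine ⟨hf.1.const_mul a, hf.2.1.const_mul a, ?_⟩
    have : deriv (fun x => a * f x) = fun x => a * deriv f x :=
      funext fun x => deriv_const_mul a (hf.1 x)
    rw [this]
    exact ih hf.2.2

theorem mul (hf : Reg ∞ n f) (hg : Reg p n g) : Reg p n (fun x => f x * g x) := by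
  induction n generalizing f g with
  | zero => exact ⟨hf.1.mul hg.1, hg.2.mul hf.2⟩
  | succ n ih =>
    refine ⟨hf.1.mul hg.1, hg.2.1.mul hf.2.1, ?_⟩
    have : deriv (fun x => f x * g x) = fun x => deriv f x * g x + f x * deriv g x :=
      funext fun x => deriv_fun_mul (hf.1 x) (hg.1 x)
    rw [this]
    exact (ih hf.2.2 hg.of_succ).add (ih hf.of_succ hg.2.2)

theorem conj (hf : Reg p n f) : Reg p n (fun x => (starRingEnd ℂ) (f x)) := by
  induction n generalizing f with
  | zero => exact ⟨hf.1.star, hf.2.star⟩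
  | succ n ih =>
    have hd : ∀ x, HasDerivAt (fun x => (starRingEnd ℂ) (f x)) ((starRingEnd ℂ) (deriv f x)) x :=
      fun x => (hf.1 x).hasDerivAt.star
    refine ⟨fun x => (hd x).differentiableAt, hf.2.1.star, ?_⟩
    have : deriv (fun x => (starRingEnd ℂ) (f x)) = fun x => (starRingEnd ℂ) (deriv f x) :=
      funext fun x => (hd x).deriv
    rw [this]
    exact ih hf.2.2

end Reg

/-- A function which is square integrable along with its derivative vanishes at infinity. -/
theorem tendsto_cocompact_of_memLp_two {f : ℝ → ℂ} (hd : Differentiable ℝ f) (hf : MemLp f 2)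
    (hf' : MemLp (deriv f) 2) : Tendsto f (cocompact ℝ) (𝓝 0) := by
  have h1 : Integrable (fun x => f x * f x) := integrable_mul_of_memLp_two hf hf
  have h2 : Integrable (fun x => deriv f x * f x + f x * deriv f x) :=
    (integrable_mul_of_memLp_two hf' hf).add (integrable_mul_of_memLp_two hf hf')
  have hder : ∀ x, HasDerivAt (fun x => f x * f x) (deriv f x * f x + f x * deriv f x) x :=
    fun x => (hd x).hasDerivAt.mul (hd x).hasDerivAt
  have hsq : Tendsto (fun x => f x * f x) (cocompact ℝ) (𝓝 0) := by
    rw [cocompact_eq_atBot_atTop, tendsto_sup]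
    exact ⟨tendsto_zero_of_hasDerivAt_of_integrableOn_Iic (a := 0) (fun x _ => hder x)
        h2.integrableOn h1.integrableOn,
      tendsto_zero_of_hasDerivAt_of_integrableOn_Ioi (a := 0) (fun x _ => hder x)
        h2.integrableOn h1.integrableOn⟩
  rw [tendsto_zero_iff_norm_tendsto_zero] at hsq ⊢
  have := hsq.sqrt
  simpa [Real.sqrt_mul_self] using this

theorem ae_norm_le_of_memLp_top {f : ℝ → ℂ} (hf : MemLp f ∞) :
    ∀ᵐ x, ‖f x‖ ≤ (eLpNorm f ∞ volume).toReal := by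
  filter_upwards [ae_le_eLpNormEssSup (f := f) (μ := (volume : Measure ℝ))] with y hy
  rw [← eLpNorm_exponent_top] at hy
  simpa using ENNReal.toReal_mono hf.2.ne hy

theorem bounded_of_tendsto_cocompact {f : ℝ → ℂ} (hf : Continuous f)
    (h : Tendsto f (cocompact ℝ) (𝓝 0)) : ∃ C, ∀ x, ‖f x‖ ≤ C := by
  let F : ZeroAtInftyContinuousMap ℝ ℂ := ⟨⟨f, hf⟩, h⟩
  exact ⟨‖F.toBCF‖, fun x => F.toBCF.norm_coe_le_norm x⟩

theorem memLp_top_of_tendsto_cocompact {f : ℝ → ℂ} (hf : Continuous f)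
    (h : Tendsto f (cocompact ℝ) (𝓝 0)) : MemLp f ∞ := by
  obtain ⟨C, hC⟩ := bounded_of_tendsto_cocompact hf h
  exact memLp_top_of_bound hf.aestronglyMeasurable C (Eventually.of_forall hC)

namespace Reg

variable {n : ℕ} {f g : ℝ → ℂ}

theorem tendsto_cocompact (h : Reg 2 (n + 1) f) : Tendsto f (cocompact ℝ) (𝓝 0) :=
  tendsto_cocompact_of_memLp_two h.1 h.memLp h.2.2.memLp

theorem top (h : Reg 2 (n + 1) f) : Reg ∞ n f := by
  induction n generalizing f with
  | zero => exact ⟨h.continuous, memLp_top_of_tendsto_cocompact h.continuous h.tendsto_cocompact⟩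
  | succ n ih =>
    exact ⟨h.1, memLp_top_of_tendsto_cocompact h.continuous h.tendsto_cocompact, ih h.2.2⟩

/-- A continuous function in `L^∞` is bounded everywhere. -/
theorem exists_bound (h : Reg ∞ n f) : ∃ C, ∀ x, ‖f x‖ ≤ C := by
  refine ⟨(eLpNorm f ∞ volume).toReal, fun x => ?_⟩
  have hcl : IsClosed {x | ‖f x‖ ≤ (eLpNorm f ∞ volume).toReal} :=
    isClosed_le h.continuous.norm continuous_const
  have hd : Dense {x | ‖f x‖ ≤ (eLpNorm f ∞ volume).toReal} := 
    Measure.dense_of_ae (ae_norm_le_of_memLp_top h.memLp)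
  have := hd x
  rwa [hcl.closure_eq] at this

theorem exists_bound_iteratedDeriv (h : Reg ∞ n f) : ∃ C, ∀ x, ‖iteratedDeriv n f x‖ ≤ C := by
  induction n generalizing f with
  | zero => simpa using h.exists_bound
  | succ n ih => rw [iteratedDeriv_succ']; exact ih h.2.2

/-- The Fourier transform of a function with `n` derivatives in `L²` has `n` moments in `L²`. -/
theorem memLp_pow_mul {h : ℝ → ℂ} (hf : Reg 2 n f) (H : IsFourierPair f h) :
    ∀ j ≤ n, MemLp (fun ξ : ℝ => (ξ : ℂ) ^ j * h ξ) 2 := by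
  induction n generalizing f h with
  | zero => intro j hj; obtain rfl : j = 0 := by omega
            simpa using H.right
  | succ n ih =>
    intro j hj
    cases j with
    | zero => simpa using H.right
    | succ j =>
      have h1 := (ih hf.2.2 (H.deriv hf.1 hf.2.2.memLp) j (by omega)).const_mul
        ((2 * Real.pi * Complex.I)⁻¹)
      refine h1.congr_norm ?_ (Eventually.of_forall fun ξ => ?_)
      · exact (((Complex.continuous_ofReal.pow _).aestronglyMeasurable).mul
          H.right.aestronglyMeasurable)
      · have hpi : (Real.pi : ℂ) ≠ 0 := by exact_mod_cast Real.pi_ne_zero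
        congr 1
        field_simp [Complex.I_ne_zero]
        ring

end Reg

/-- Two moments in `L²` give integrability: `h` is the product of the square integrable functions
`(1 + iξ)⁻¹` and `(1 + iξ) h`. -/
theorem integrable_of_memLp_mul {h : ℝ → ℂ} (h0 : MemLp h 2)
    (h1 : MemLp (fun ξ : ℝ => (ξ : ℂ) * h ξ) 2) : Integrable h := by
  have hne : ∀ ξ : ℝ, (1 + Complex.I * ξ : ℂ) ≠ 0 := fun ξ hξ => by
    simpa using congrArg Complex.re hξ
  have hm : MemLp (fun ξ : ℝ => (1 + Complex.I * ξ : ℂ)⁻¹) 2 := by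
    have hc : Continuous (fun ξ : ℝ => (1 + Complex.I * ξ : ℂ)⁻¹) :=
      Continuous.inv₀ (by fun_prop) hne
    rw [memLp_two_iff_integrable_sq_norm hc.aestronglyMeasurable]
    refine integrable_inv_one_add_sq.congr (Eventually.of_forall fun ξ => ?_)
    have : ‖(1 + Complex.I * ξ : ℂ)‖ ^ 2 = 1 + ξ ^ 2 := by
      rw [Complex.sq_norm, Complex.normSq_apply]; simp; ring
    simp only [norm_inv, inv_pow, this]
  have hs : MemLp (fun ξ : ℝ => h ξ + Complex.I * ((ξ : ℂ) * h ξ)) 2 := h0.add (h1.const_mul _)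
  refine (integrable_mul_of_memLp_two hm hs).congr (Eventually.of_forall fun ξ => ?_)
  have := hne ξ
  field_simp

theorem hasDerivAt_fourierInv {h : ℝ → ℂ} (hi : Integrable h)
    (hi' : Integrable (fun ξ : ℝ => (2 * Real.pi * Complex.I * ξ) * h ξ)) (x : ℝ) :
    HasDerivAt (𝓕⁻ h) ((𝓕⁻ fun ξ : ℝ => (2 * Real.pi * Complex.I * ξ) * h ξ) x) x := by
  have hpi : (Real.pi : ℂ) ≠ 0 := by exact_mod_cast Real.pi_ne_zero
  rw [Real.fourierInv_eq_fourier_comp_neg, Real.fourierInv_eq_fourier_comp_neg]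
  have hi'' : Integrable (fun ξ : ℝ => ξ • h (-ξ)) := by
    refine ((hi'.comp_neg).const_mul (-(2 * Real.pi * Complex.I)⁻¹)).congr
      (Eventually.of_forall fun ξ => ?_)
    simp only [Complex.real_smul, Complex.ofReal_neg]
    field_simp [Complex.I_ne_zero]
  refine (Real.hasDerivAt_fourier hi.comp_neg hi'' x).congr_deriv
    (congrArg (fun F : ℝ → ℂ => 𝓕 F x) (funext fun ξ => ?_))
  rw [smul_eq_mul]
  push_cast
  ring

/-- A function in `L²` whose Fourier transform has `n + 1` moments in `L²` coincides almost
everywhere with a `C^n` function whose derivatives up to order `n` are in `L²`. -/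
theorem IsFourierPair.exists_reg {n : ℕ} {f h : ℝ → ℂ} (H : IsFourierPair f h)
    (hm : ∀ j ≤ n + 1, MemLp (fun ξ : ℝ => (ξ : ℂ) ^ j * h ξ) 2) :
    ∃ f₀, f =ᵐ[volume] f₀ ∧ Reg 2 n f₀ := by
  induction n generalizing f h with
  | zero =>
    have hi : Integrable h := integrable_of_memLp_mul H.right (by simpa using hm 1 le_rfl)
    have K := IsFourierPair.fourierInv H.right hi
    exact ⟨_, H.left_ae_eq K, continuous_fourierInv hi, K.left⟩
  | succ n ih =>
    have hi : Integrable h := integrable_of_memLp_mul H.right (by simpa using hm 1 (by omega))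
    have K := IsFourierPair.fourierInv H.right hi
    set k : ℝ → ℂ := fun ξ => (2 * Real.pi * Complex.I * ξ) * h ξ with hk
    have hkj : ∀ j, j + 1 ≤ n + 2 → MemLp (fun ξ : ℝ => (ξ : ℂ) ^ j * k ξ) 2 := fun j hj => by
      convert (hm (j + 1) (by omega)).const_mul (2 * Real.pi * Complex.I) using 2 with ξ
      simp only [hk]
      ring
    have hk0 : MemLp k 2 := by simpa using hkj 0 (by omega)
    have hki : Integrable k := integrable_of_memLp_mul hk0 (by simpa using hkj 1 (by omega))
    have K' := IsFourierPair.fourierInv hk0 hki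
    obtain ⟨g, hg, hgr⟩ := ih K' (fun j hj => hkj j (by omega))
    have hgk : 𝓕⁻ k = g :=
      ((continuous_fourierInv hki).ae_eq_iff_eq volume hgr.continuous).1 hg
    have hder : ∀ x, HasDerivAt (𝓕⁻ h) ((𝓕⁻ k) x) x := hasDerivAt_fourierInv hi hki
    refine ⟨_, H.left_ae_eq K, fun x => (hder x).differentiableAt, K.left, ?_⟩
    rw [show _root_.deriv (𝓕⁻ h) = g from hgk ▸ funext fun x => (hder x).deriv]
    exact hgr

/-! ### Weak derivatives on the line -/

/-- Integration by parts for the primitive of an integrable function. -/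
theorem integral_primitive_mul_deriv {w : ℝ → ℂ} (hw : Integrable w) {φ : ℝ → ℂ}
    (hφ : IsTestFunction φ) :
    ∫ x, (∫ t in Set.Iic x, w t) * deriv φ x = - ∫ x, w x * φ x := by
  have hφ1 : ContDiff ℝ 1 φ := hφ.1.of_le (by simp)
  have hd : Integrable (deriv φ) :=
    (hφ1.continuous_deriv le_rfl).integrable_of_hasCompactSupport hφ.2.deriv
  have hS : MeasurableSet {z : ℝ × ℝ | z.2 ≤ z.1} := measurableSet_le measurable_snd measurable_fst
  have hint : Integrable (Function.uncurry fun x t : ℝ =>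
      {z : ℝ × ℝ | z.2 ≤ z.1}.indicator (fun z => deriv φ z.1 * w z.2) (x, t))
      (volume.prod volume) := (hd.mul_prod hw).indicator hS
  have hswap := integral_integral_swap hint
  have h1 : ∀ x, ∫ t, {z : ℝ × ℝ | z.2 ≤ z.1}.indicator (fun z => deriv φ z.1 * w z.2) (x, t) =
      (∫ t in Set.Iic x, w t) * deriv φ x := fun x => by
    rw [mul_comm, ← integral_const_mul, ← integral_indicator measurableSet_Iic]
    refine integral_congr_ae (Eventually.of_forall fun t => ?_)
    by_cases h : t ≤ x <;> simp [Set.indicator, h]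
  have h2 : ∀ t, ∫ x, {z : ℝ × ℝ | z.2 ≤ z.1}.indicator (fun z => deriv φ z.1 * w z.2) (x, t) =
      -(w t * φ t) := fun t => by
    have h3 : ∫ x in Set.Ioi t, deriv φ x = - φ t := hφ.2.integral_Ioi_deriv_eq hφ1 t
    rw [← mul_neg, ← h3, ← integral_Ici_eq_integral_Ioi, ← integral_const_mul,
      ← integral_indicator measurableSet_Ici]
    refine integral_congr_ae (Eventually.of_forall fun x => ?_)
    by_cases h : t ≤ x <;> simp [Set.indicator, h, mul_comm]
  simp only [h1, h2] at hswap
  rw [hswap, integral_neg]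

theorem IsTestFunction.exists_support_subset {φ : ℝ → ℂ} (hφ : IsTestFunction φ) :
    ∃ R > 0, ∀ x, R < |x| → φ x = 0 := by
  obtain ⟨R, hR, h⟩ := hφ.2.isBounded.exists_pos_norm_le
  refine ⟨R, hR, fun x hx => ?_⟩
  by_contra hne
  have := h x (subset_tsupport φ hne)
  rw [Real.norm_eq_abs] at this
  linarith

theorem IsTestFunction.deriv {φ : ℝ → ℂ} (hφ : IsTestFunction φ) : IsTestFunction (deriv φ) :=
  ⟨(contDiff_infty_iff_deriv.1 hφ.1).2, hφ.2.deriv⟩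

theorem IsTestFunction.continuous {φ : ℝ → ℂ} (hφ : IsTestFunction φ) : Continuous φ :=
  hφ.1.continuous

theorem IsTestFunction.integrable_mul {φ u : ℝ → ℂ} (hφ : IsTestFunction φ)
    (hu : LocallyIntegrable u) : Integrable (fun x => u x * φ x) :=
  hu.integrable_smul_right_of_hasCompactSupport hφ.continuous hφ.2

theorem intervalIntegrable_of_locallyIntegrable {v : ℝ → ℂ} (hv : LocallyIntegrable v) (a b : ℝ) :
    IntervalIntegrable v volume a b :=
  (hv.integrableOn_isCompact isCompact_uIcc).intervalIntegrable

theorem continuous_primitive_of_locallyIntegrable {v : ℝ → ℂ} (hv : LocallyIntegrable v) :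
    Continuous (fun x => ∫ t in (0 : ℝ)..x, v t) :=
  intervalIntegral.continuous_primitive (intervalIntegrable_of_locallyIntegrable hv) 0

theorem integral_deriv_eq_zero {φ : ℝ → ℂ} (hφ : IsTestFunction φ) : ∫ x, deriv φ x = 0 :=
  integral_eq_zero_of_hasDerivAt_of_integrable
    (fun x => (hφ.1.differentiable (by simp) x).hasDerivAt)
    (hφ.deriv.continuous.integrable_of_hasCompactSupport hφ.deriv.2)
    (hφ.continuous.integrable_of_hasCompactSupport hφ.2)

theorem hasWeakDeriv_primitive {v : ℝ → ℂ} (hv : LocallyIntegrable v) :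
    HasWeakDeriv (fun x => ∫ t in (0 : ℝ)..x, v t) v := by
  refine ⟨(continuous_primitive_of_locallyIntegrable hv).locallyIntegrable, hv, fun φ hφ => ?_⟩
  obtain ⟨R, hR, hsupp⟩ := hφ.exists_support_subset
  have hsupp' : ∀ x, R < |x| → deriv φ x = 0 := fun x hx => by
    have : φ =ᶠ[𝓝 x] fun _ => 0 := by
      filter_upwards [(isOpen_lt continuous_const continuous_abs).mem_nhds hx] with y hy
      exact hsupp y hy
    rw [this.deriv_eq, deriv_const]
  have hvi : IntegrableOn v (Set.Icc (-R) R) := hv.integrableOn_isCompact isCompact_Icc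
  have hw : Integrable ((Set.Icc (-R) R).indicator v) := hvi.integrable_indicator measurableSet_Icc
  have key := integral_primitive_mul_deriv hw hφ
  -- On the support of `φ` the primitives from `-∞` (of the truncation of `v`) and from `0` differ
  -- by a constant, which `φ'` does not see.
  have h1 : ∀ x, (∫ t in Set.Iic x, (Set.Icc (-R) R).indicator v t) * deriv φ x =
      (∫ t in (0 : ℝ)..x, v t) * deriv φ x - (∫ t in (0 : ℝ)..(-R), v t) * deriv φ x := by
    intro x
    by_cases hx : R < |x|
    · simp [hsupp' x hx]
    · rw [not_lt, abs_le] at hx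
      rw [← sub_mul, intervalIntegral.integral_interval_sub_left
        (intervalIntegrable_of_locallyIntegrable hv _ _)
        (intervalIntegrable_of_locallyIntegrable hv _ _),
        intervalIntegral.integral_of_le hx.1, setIntegral_indicator measurableSet_Icc,
        ← integral_Icc_eq_integral_Ioc]
      congr 2
      congr 1
      ext t
      simp only [Set.mem_inter_iff, Set.mem_Iic, Set.mem_Icc]
      constructor
      · rintro ⟨h1, h2, h3⟩; exact ⟨h2, h1⟩
      · rintro ⟨h1, h2⟩; exact ⟨h2, h1, h2.trans hx.2⟩
  have h2 : ∀ x, (Set.Icc (-R) R).indicator v x * φ x = v x * φ x := by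
    intro x
    by_cases hx : x ∈ Set.Icc (-R) R
    · rw [Set.indicator_of_mem hx]
    · rw [Set.indicator_of_notMem hx, hsupp x, mul_zero, mul_zero]
      by_contra hn
      exact hx (abs_le.1 (not_lt.1 hn))
  simp only [h1, h2] at key
  rw [integral_sub (hφ.deriv.integrable_mul
    (continuous_primitive_of_locallyIntegrable hv).locallyIntegrable)
    ((hφ.deriv.continuous.integrable_of_hasCompactSupport hφ.deriv.2).const_mul _),
    integral_const_mul, integral_deriv_eq_zero hφ, mul_zero, sub_zero] at key
  exact key

/-- A locally integrable function with zero weak derivative is constant (du Bois-Reymond). -/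
theorem ae_eq_const_of_integral_mul_deriv_eq_zero {d : ℝ → ℂ} (hd : LocallyIntegrable d)
    (h : ∀ φ, IsTestFunction φ → ∫ x, d x * deriv φ x = 0) : ∃ C, d =ᵐ[volume] fun _ => C := by
  obtain ⟨b⟩ : Nonempty (ContDiffBump (0 : ℝ)) := inferInstance
  set θ : ℝ → ℂ := fun x => (b.normed volume x : ℂ) with hθ
  have hθt : IsTestFunction θ :=
    ⟨Complex.ofRealCLM.contDiff.comp b.contDiff_normed,
      b.hasCompactSupport_normed.comp_left (g := ((↑) : ℝ → ℂ)) rfl⟩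
  have hθ1 : ∫ x, θ x = 1 := by
    rw [hθ, integral_complex_ofReal, b.integral_normed, Complex.ofReal_one]
  refine ⟨∫ x, d x * θ x, ae_eq_of_integral_contDiff_smul_eq hd
    continuous_const.locallyIntegrable fun ψ hψ hψc => ?_⟩
  have hψt : IsTestFunction fun x => (ψ x : ℂ) :=
    ⟨Complex.ofRealCLM.contDiff.comp hψ, hψc.comp_left (g := ((↑) : ℝ → ℂ)) rfl⟩
  -- Subtracting a multiple of `θ` makes the integral of `ψ` vanish, so that the difference is the
  -- derivative of a test function.
  set I : ℂ := ∫ x, (ψ x : ℂ) with hI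
  set q : ℝ → ℂ := fun x => (ψ x : ℂ) - I * θ x with hq
  have hqt : IsTestFunction q := ⟨hψt.1.sub (contDiff_const.mul hθt.1), hψt.2.sub (hθt.2.mul_left)⟩
  have hψi := hψt.continuous.integrable_of_hasCompactSupport hψt.2 (μ := volume)
  have hθi := hθt.continuous.integrable_of_hasCompactSupport hθt.2 (μ := volume)
  have hqi := hqt.continuous.integrable_of_hasCompactSupport hqt.2 (μ := volume)
  have hq0 : ∫ x, q x = 0 := by
    rw [hq, integral_sub hψi (hθi.const_mul I), integral_const_mul, hθ1, mul_one, sub_self]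
  obtain ⟨R, hR, hsupp⟩ := hqt.exists_support_subset
  set φ : ℝ → ℂ := fun x => ∫ t in Set.Iic x, q t with hφ
  have hder : ∀ x, HasDerivAt φ (q x) x := by
    intro x
    have h1 : ∀ y, φ y = φ 0 + ∫ t in (0 : ℝ)..y, q t := fun y => by
      rw [← intervalIntegral.integral_Iic_sub_Iic hqi.integrableOn hqi.integrableOn]
      simp [hφ]
    have h2 := (intervalIntegral.integral_hasDerivAt_right
      (hqt.continuous.intervalIntegrable 0 x)
      hqt.continuous.stronglyMeasurable.stronglyMeasurableAtFilter
      hqt.continuous.continuousAt).const_add (φ 0)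
    exact h2.congr_of_eventuallyEq (Eventually.of_forall h1)
  have hderiv : deriv φ = q := funext fun x => (hder x).deriv
  have hφt : IsTestFunction φ := by
    constructor
    · rw [contDiff_infty_iff_deriv, hderiv]
      exact ⟨fun x => (hder x).differentiableAt, hqt.1⟩
    · refine HasCompactSupport.intro (isCompact_Icc (a := -R) (b := R)) fun x hx => ?_
      rw [Set.mem_Icc, not_and_or, not_le, not_le] at hx
      rcases hx with hx | hx
      · refine setIntegral_eq_zero_of_forall_eq_zero fun t ht => hsupp t ?_
        rw [Set.mem_Iic] at ht
        rw [lt_abs]; right; linarith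
      · have hz : ∫ t in Set.Ioi x, q t = 0 :=
          setIntegral_eq_zero_of_forall_eq_zero fun t ht => hsupp t (by
            rw [Set.mem_Ioi] at ht
            rw [lt_abs]; left; linarith)
        have := intervalIntegral.integral_Iic_add_Ioi (b := x) hqi.integrableOn hqi.integrableOn
        rw [hz, hq0, add_zero] at this
        exact this
  have := h φ hφt
  rw [hderiv] at this
  have e : ∀ x, d x * q x = d x * (ψ x : ℂ) - I * (d x * θ x) := fun x => by
    simp only [hq]; ring
  simp only [e] at this
  rw [integral_sub (hψt.integrable_mul hd) ((hθt.integrable_mul hd).const_mul I),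
    integral_const_mul, sub_eq_zero] at this
  calc ∫ x, ψ x • d x = ∫ x, d x * (ψ x : ℂ) := by simp only [Complex.real_smul, mul_comm]
    _ = I * ∫ x, d x * θ x := this
    _ = ∫ x, ψ x • ∫ x, d x * θ x := by
      simp only [Complex.real_smul]; rw [integral_mul_const]

/-- A function with a locally integrable weak derivative is a primitive of it. -/
theorem HasWeakDeriv.exists_primitive {u v : ℝ → ℂ} (h : HasWeakDeriv u v) :
    ∃ C, u =ᵐ[volume] fun x => C + ∫ t in (0 : ℝ)..x, v t := by
  have hp := hasWeakDeriv_primitive h.2.1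
  obtain ⟨C, hC⟩ := ae_eq_const_of_integral_mul_deriv_eq_zero (h.1.sub hp.1) fun φ hφ => by
    simp only [Pi.sub_apply, sub_mul]
    rw [integral_sub (hφ.deriv.integrable_mul h.1) (hφ.deriv.integrable_mul hp.1),
      h.2.2 φ hφ, hp.2.2 φ hφ, sub_self]
  refine ⟨C, hC.mono fun x hx => ?_⟩
  simp only [Pi.sub_apply] at hx
  rw [← hx]; ring

/-! ### A bounded `C^1` representative of the traveling wave -/

theorem locallyIntegrable_of_memLp_two_top {u g : ℝ → ℂ} (hu : MemLp u ∞) (hg : MemLp g 2) :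
    LocallyIntegrable (fun x => u x * g x) :=
  locallyIntegrable_of_memLp_two (hg.mul hu)

/-- A function of finite energy is bounded: by the bound on the derivative its modulus
varies by a bounded amount on intervals of length one, while `1 - |f|²` is square integrable. -/
theorem bounded_of_memLp_eta {f v : ℝ → ℂ} (hη : MemLp (eta f) 2)
    (hv : MemLp v 2) (hfv : ∀ x y, f y - f x = ∫ t in x..y, v t) : ∃ B, ∀ x, ‖f x‖ ≤ B := by
  have hvl := locallyIntegrable_of_memLp_two hv
  have hv2 : Integrable (fun t => ‖v t‖ ^ 2) :=
    (memLp_two_iff_integrable_sq_norm hv.aestronglyMeasurable).1 hv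
  set A : ℝ := 1 + ∫ t, ‖v t‖ ^ 2 with hA
  have hvar : ∀ x y, x ≤ y → y ≤ x + 1 → ‖f y - f x‖ ≤ A := by
    intro x y hxy hy
    have hvi := intervalIntegrable_of_locallyIntegrable hvl x y
    calc ‖f y - f x‖ ≤ ∫ t in x..y, ‖v t‖ := by
          rw [hfv]; exact intervalIntegral.norm_integral_le_integral_norm hxy
      _ ≤ ∫ t in x..y, (1 + ‖v t‖ ^ 2) := by
          refine intervalIntegral.integral_mono_on hxy hvi.norm
            (intervalIntegrable_const.add hv2.intervalIntegrable) fun t _ => ?_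
          nlinarith [sq_nonneg (‖v t‖ - 1), norm_nonneg (v t)]
      _ = (y - x) + ∫ t in x..y, ‖v t‖ ^ 2 := by
          rw [intervalIntegral.integral_add intervalIntegrable_const hv2.intervalIntegrable]
          simp
      _ ≤ A := by
          rw [intervalIntegral.integral_of_le hxy]
          have := setIntegral_le_integral (s := Set.Ioc x y) hv2
            (Eventually.of_forall fun t => by positivity)
          rw [hA]; linarith
  have hη2 : Integrable (fun t => eta f t ^ 2) := hη.integrable_sq
  set J : ℝ := ∫ t, eta f t ^ 2 with hJ
  have hJ0 : 0 ≤ J := integral_nonneg fun t => sq_nonneg _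
  -- A value above `A + (J + 2)` would keep `η² ≥ J + 1` on an interval of length one.
  refine ⟨A + (J + 2), fun x => ?_⟩
  by_contra! hx
  have hlow : ∀ t ∈ Set.Icc x (x + 1), J + 1 ≤ eta f t ^ 2 := by
    intro t ht
    have h1 := hvar x t ht.1 ht.2
    have h2 : ‖f x‖ ≤ ‖f t‖ + ‖f t - f x‖ := by
      have := norm_sub_le (f t) (f t - f x)
      simpa using this
    have h3 : J + 2 ≤ ‖f t‖ := by linarith
    have h4 : J + 2 ≤ ‖f t‖ ^ 2 := by nlinarith
    rw [eta]
    nlinarith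
  have h5 : ∫ t in x..(x + 1), (J + 1) ≤ ∫ t in x..(x + 1), eta f t ^ 2 :=
    intervalIntegral.integral_mono_on (by linarith) intervalIntegrable_const
      hη2.intervalIntegrable hlow
  have h6 : ∫ t in x..(x + 1), eta f t ^ 2 ≤ J := by
    rw [intervalIntegral.integral_of_le (by linarith)]
    exact setIntegral_le_integral hη2 (Eventually.of_forall fun t => sq_nonneg _)
  rw [intervalIntegral.integral_const] at h5
  simp only [smul_eq_mul] at h5
  linarith

theorem IsConvolution.congr {W : 𝓢'(ℝ, ℂ)} {f f' g : ℝ → ℂ} (h : IsConvolution W f g)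
    (hf : f =ᵐ[volume] f') : IsConvolution W f' g := by
  have hae : ∀ φ : 𝓢(ℝ, ℂ), (fun x => f x * W (SchwartzMap.compSubConstCLM ℂ (-x) φ)) =ᵐ[volume]
      fun x => f' x * W (SchwartzMap.compSubConstCLM ℂ (-x) φ) := fun φ =>
    hf.mono fun x hx => by simp only [hx]
  refine ⟨h.1.ae_eq hf, h.2.1, fun φ => ⟨(h.2.2 φ).1.congr (hae φ), ?_⟩⟩
  rw [(h.2.2 φ).2, integral_congr_ae (hae φ)]

/-- A finite energy traveling wave has a bounded `C^1` representative `v`, which solves the equation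
integrated once. -/
theorem exists_C1_representative {W : 𝓢'(ℝ, ℂ)} {c : ℝ} {u : ℝ → ℂ} (hu : InEnergySpace u)
    (hsol : IsTravelingWave W c u) :
    ∃ (v g : ℝ → ℂ) (C : ℂ), u =ᵐ[volume] v ∧ Differentiable ℝ v ∧ Continuous (deriv v) ∧
      MemLp (deriv v) 2 ∧ MemLp v ∞ ∧ IsConvolution W (fun x => (eta v x : ℂ)) g ∧
      ∀ x, deriv v x = C - (∫ t in (0 : ℝ)..x, v t * g t) - Complex.I * c * v x := by
  obtain ⟨-, hη, du, hweak, hdu⟩ := hu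
  obtain ⟨g, hconv, hsol⟩ := hsol
  obtain ⟨C₀, hC₀⟩ := hweak.exists_primitive
  set v : ℝ → ℂ := fun x => C₀ + ∫ t in (0 : ℝ)..x, du t with hv
  have hdul := locallyIntegrable_of_memLp_two hdu
  have hvc : Continuous v :=
    continuous_const.add (continuous_primitive_of_locallyIntegrable hdul)
  have hηae : eta u =ᵐ[volume] eta v := hC₀.mono fun x hx => by simp only [eta, hx]
  have hsub : ∀ x y, v y - v x = ∫ t in x..y, du t := fun x y => by
    simp only [hv, add_sub_add_left_eq_sub]
    exact intervalIntegral.integral_interval_sub_left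
      (intervalIntegrable_of_locallyIntegrable hdul _ _)
      (intervalIntegrable_of_locallyIntegrable hdul _ _)
  obtain ⟨B, hB⟩ := bounded_of_memLp_eta (hη.ae_eq hηae) hdu hsub
  have hvtop : MemLp v ∞ := memLp_top_of_bound hvc.aestronglyMeasurable B (Eventually.of_forall hB)
  have hg : MemLp g 2 := hconv.2.1
  have hvg : LocallyIntegrable (fun x => v x * g x) := locallyIntegrable_of_memLp_two_top hvtop hg
  have hvl : LocallyIntegrable v := hvc.locallyIntegrable
  -- The equation says that `u' + icu` has weak derivative `-u g`.
  have hweak2 : HasWeakDeriv (fun x => du x + Complex.I * c * v x) (fun x => -(v x * g x)) := by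
    have hcv : LocallyIntegrable fun x => Complex.I * c * v x :=
      (continuous_const.mul hvc).locallyIntegrable
    refine ⟨hdul.add hcv, hvg.neg, fun φ hφ => ?_⟩
    have h1 := hweak.2.2 _ hφ.deriv
    have h2 := hsol φ hφ
    have h3 : ∫ x, (-(Complex.I * c * v x * deriv φ x) + v x * deriv (deriv φ) x
        + v x * g x * φ x) = 0 := by
      rw [← h2]
      refine integral_congr_ae (hC₀.mono fun x hx => ?_)
      simp only [hx, iteratedDeriv_succ, iteratedDeriv_zero]
    have h4 : ∫ x, v x * deriv (deriv φ) x = -∫ x, du x * deriv φ x := by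
      rw [← h1]
      exact integral_congr_ae (hC₀.mono fun x hx => by simp only [hx])
    have i1 := hφ.deriv.integrable_mul hcv
    have i2 := hφ.deriv.deriv.integrable_mul hvl
    have i3 := hφ.integrable_mul hvg
    have i4 := hφ.deriv.integrable_mul hdul
    have i1' : Integrable (fun x => -(Complex.I * c * v x * deriv φ x)) := i1.neg
    have i12 : Integrable (fun x => -(Complex.I * c * v x * deriv φ x) + v x * deriv (deriv φ) x) :=
      i1'.add i2
    rw [integral_add i12 i3, integral_add i1' i2, integral_neg, h4] at h3
    simp only [add_mul, neg_mul]
    rw [integral_add i4 i1, integral_neg, neg_neg]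
    linear_combination -h3
  obtain ⟨C, hC⟩ := hweak2.exists_primitive
  set r : ℝ → ℂ := fun x => C - (∫ t in (0 : ℝ)..x, v t * g t) - Complex.I * c * v x with hr
  have hrc : Continuous r := (continuous_const.sub
    (continuous_primitive_of_locallyIntegrable hvg)).sub (continuous_const.mul hvc)
  have hdur : du =ᵐ[volume] r := hC.mono fun x hx => by
    simp only [intervalIntegral.integral_neg] at hx
    simp only [hr]
    linear_combination hx
  have hder : ∀ x, HasDerivAt v (r x) x := fun x => by
    have h1 : ∀ y, v y = C₀ + ∫ t in (0 : ℝ)..y, r t := fun y => by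
      simp only [hv]
      rw [intervalIntegral.integral_congr_ae (hdur.mono fun t ht _ => ht)]
    have h2 := (intervalIntegral.integral_hasDerivAt_right (hrc.intervalIntegrable 0 x)
      hrc.stronglyMeasurable.stronglyMeasurableAtFilter hrc.continuousAt).const_add C₀
    exact h2.congr_of_eventuallyEq (Eventually.of_forall h1)
  have hderiv : deriv v = r := funext fun x => (hder x).deriv
  refine ⟨v, g, C, hC₀, fun x => (hder x).differentiableAt, hderiv ▸ hrc,
    hderiv ▸ hdu.ae_eq hdur, hvtop, hconv.congr (hηae.mono fun x hx => by simp only [hx]),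
    fun x => by rw [hderiv]⟩

/-! ### The potential as a bounded Fourier multiplier -/

theorem angDilation_apply (x : ℝ) : angDilation x = x * (2 * Real.pi)⁻¹ := by
  simp [angDilation, ContinuousLinearEquiv.unitsEquivAut]

/-- Every Fourier transform of a Schwartz function is, after a dilation, an angular one. -/
theorem angFourier_dilation (ψ : 𝓢(ℝ, ℂ)) :
    angFourier ((2 * Real.pi : ℂ)⁻¹ •
      SchwartzMap.compCLMOfContinuousLinearEquiv ℂ angDilation ψ) = 𝓕 ψ := by
  have hpi : (Real.pi : ℂ) ≠ 0 := by exact_mod_cast Real.pi_ne_zero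
  have hpos : (0 : ℝ) < 2 * Real.pi := by positivity
  ext x
  rw [angFourier_apply, SchwartzMap.fourier_coe, Real.fourier_real_eq_integral_exp_smul]
  have h := Measure.integral_comp_mul_left (fun s : ℝ => Complex.exp (-(Complex.I * s * x)) *
    ((2 * Real.pi : ℂ)⁻¹ • SchwartzMap.compCLMOfContinuousLinearEquiv ℂ angDilation ψ) s)
    (2 * Real.pi)
  rw [abs_of_pos (inv_pos.2 hpos), eq_comm, inv_smul_eq_iff₀ hpos.ne'] at h
  rw [h, ← integral_smul]
  refine integral_congr_ae (Eventually.of_forall fun t => ?_)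
  have h1 : angDilation (2 * Real.pi * t) = t := by
    rw [angDilation_apply]; field_simp
  simp only [smul_apply, SchwartzMap.compCLMOfContinuousLinearEquiv_apply,
    Function.comp_apply, h1, smul_eq_mul, Complex.real_smul]
  have h2 : -(Complex.I * ((2 * Real.pi * t : ℝ) : ℂ) * x) =
      ((-2 * Real.pi * t * x : ℝ) : ℂ) * Complex.I := by push_cast; ring
  rw [h2]
  push_cast
  field_simp

/-- In Mathlib's normalization the Fourier transform of `T` is `ξ ↦ g (2πξ)`. -/
theorem HasFourierTransform.apply_fourier {T : 𝓢'(ℝ, ℂ)} {g : ℝ → ℂ}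
    (h : HasFourierTransform T g) (ψ : 𝓢(ℝ, ℂ)) :
    Integrable (fun ξ : ℝ => g (2 * Real.pi * ξ) * ψ ξ) ∧
      T (𝓕 ψ) = ∫ ξ : ℝ, g (2 * Real.pi * ξ) * ψ ξ := by
  have hpi : (Real.pi : ℂ) ≠ 0 := by exact_mod_cast Real.pi_ne_zero
  have hpos : (0 : ℝ) < 2 * Real.pi := by positivity
  set φ : 𝓢(ℝ, ℂ) := (2 * Real.pi : ℂ)⁻¹ •
      SchwartzMap.compCLMOfContinuousLinearEquiv ℂ angDilation ψ with hφ
  obtain ⟨hi, hT⟩ := h φ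
  have h0 : ∀ ξ : ℝ, φ (2 * Real.pi * ξ) = (2 * Real.pi : ℂ)⁻¹ * ψ ξ := fun ξ => by
    have h1 : angDilation (2 * Real.pi * ξ) = ξ := by
      rw [angDilation_apply]; field_simp
    simp only [hφ, smul_apply, SchwartzMap.compCLMOfContinuousLinearEquiv_apply,
      Function.comp_apply, h1, smul_eq_mul]
  have h2 : ∀ ξ : ℝ, (2 * Real.pi : ℂ) * (g (2 * Real.pi * ξ) * φ (2 * Real.pi * ξ)) =
      g (2 * Real.pi * ξ) * ψ ξ := fun ξ => by
    rw [h0]; field_simp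
  constructor
  · refine ((hi.comp_mul_left' hpos.ne').const_mul (2 * Real.pi : ℂ)).congr
      (Eventually.of_forall fun ξ => h2 ξ)
  · have h3 := Measure.integral_comp_mul_left (fun s : ℝ => g s * φ s) (2 * Real.pi)
    rw [abs_of_pos (inv_pos.2 hpos), eq_comm, inv_smul_eq_iff₀ hpos.ne'] at h3
    rw [← angFourier_dilation ψ, hT, h3, Complex.real_smul, ← integral_const_mul]
    push_cast
    exact integral_congr_ae (Eventually.of_forall fun ξ => h2 ξ)

/-- Translation becomes modulation under the inverse Fourier transform. -/
theorem fourierInv_compSubConstCLM (φ : 𝓢(ℝ, ℂ)) (x ξ : ℝ) :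
    (𝓕⁻ (SchwartzMap.compSubConstCLM ℂ (-x) φ) : 𝓢(ℝ, ℂ)) ξ =
      Real.fourierChar (-(ξ * x)) • (𝓕⁻ φ : 𝓢(ℝ, ℂ)) ξ := by
  rw [SchwartzMap.fourierInv_coe, SchwartzMap.fourierInv_coe, Real.fourierInv_eq,
    Real.fourierInv_eq]
  have h := integral_add_right_eq_self (μ := (volume : Measure ℝ))
    (fun y : ℝ => Real.fourierChar (inner ℝ (y - x) ξ) • φ y) x
  simp only [add_sub_cancel_right] at h
  simp only [SchwartzMap.compSubConstCLM_apply, sub_neg_eq_add]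
  rw [h, Circle.smul_def, ← integral_smul]
  refine integral_congr_ae (Eventually.of_forall fun y => ?_)
  simp only [← Circle.smul_def, ← mul_smul, ← AddChar.map_add_eq_mul]
  congr 2
  simp only [RCLike.inner_apply, conj_trivial]
  ring

theorem quasiMeasurePreserving_const_mul {a : ℝ} (ha : a ≠ 0) :
    Measure.QuasiMeasurePreserving (fun ξ : ℝ => a * ξ) volume volume := by
  refine ⟨measurable_const_mul a, ?_⟩
  rw [Real.map_volume_mul_left ha]
  exact Measure.smul_absolutelyContinuous

theorem memLp_top_comp_mul_left {w : ℝ → ℂ} (hw : MemLp w ∞) {a : ℝ} (ha : a ≠ 0) :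
    MemLp (fun ξ => w (a * ξ)) ∞ := by
  have hq := quasiMeasurePreserving_const_mul ha
  refine memLp_top_of_bound (hw.1.comp_quasiMeasurePreserving hq)
    (eLpNorm w ∞ volume).toReal (hq.ae (ae_norm_le_of_memLp_top hw))

/-- Convolution with `W` acts on the Fourier side as multiplication by `Ŵ`. -/
theorem IsConvolution.isFourierPair {W : 𝓢'(ℝ, ℂ)} {f g w h : ℝ → ℂ} (H : IsConvolution W f g)
    (hW : HasFourierTransform W w) (hw : MemLp w ∞) (hf : IsFourierPair f h) :
    IsFourierPair g (fun ξ => w (2 * Real.pi * ξ) * h ξ) := by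
  have hw2 : MemLp (fun ξ : ℝ => w (2 * Real.pi * ξ)) ∞ :=
    memLp_top_comp_mul_left hw (by positivity)
  refine ⟨H.2.1, hf.right.mul hw2, fun ψ => ?_⟩
  set q : ℝ → ℂ := fun ξ => w (2 * Real.pi * ξ) * ψ ξ with hq
  have hqi : Integrable q := (hW.apply_fourier ψ).1
  have hq2 : MemLp q 2 := (ψ.memLp 2).mul hw2
  -- Pairing `W` with the translates of `ψ̂` gives the Fourier transform of `Ŵ ψ`.
  have hWq : ∀ x, W (SchwartzMap.compSubConstCLM ℂ (-x) (𝓕 ψ)) = 𝓕 q x := by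
    intro x
    have h1 := (hW.apply_fourier (𝓕⁻ (SchwartzMap.compSubConstCLM ℂ (-x) (𝓕 ψ)))).2
    rw [FourierTransform.fourier_fourierInv_eq] at h1
    rw [h1, Real.fourier_eq]
    refine integral_congr_ae (Eventually.of_forall fun ξ => ?_)
    simp only [fourierInv_compSubConstCLM, FourierTransform.fourierInv_fourier_eq, hq,
      Circle.smul_def, smul_eq_mul, RCLike.inner_apply, conj_trivial]
    rw [mul_comm ξ x]
    ring
  rw [(H.2.2 (𝓕 ψ)).2]
  simp only [hWq]
  rw [hf.integral_mul (IsFourierPair.fourier hq2 hqi)]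
  refine integral_congr_ae (Eventually.of_forall fun ξ => ?_)
  simp only [hq]
  ring

theorem IsConvolution.exists_reg {W : 𝓢'(ℝ, ℂ)} {f g w : ℝ → ℂ} (H : IsConvolution W f g)
    (hW : HasFourierTransform W w) (hw : MemLp w ∞) {n : ℕ} (hf : Reg 2 (n + 1) f) :
    ∃ g₀, g =ᵐ[volume] g₀ ∧ Reg 2 n g₀ := by
  obtain ⟨h, hh⟩ := IsFourierPair.exists_right hf.memLp
  refine (H.isFourierPair hW hw hh).exists_reg fun j hj => ?_
  have hw2 : MemLp (fun ξ : ℝ => w (2 * Real.pi * ξ)) ∞ :=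
    memLp_top_comp_mul_left hw (by positivity)
  convert (hf.memLp_pow_mul hh j hj).mul hw2 (r := 2) using 1
  ext ξ
  simp only [Pi.mul_apply]
  ring

/-- The convolution of a real potential with a real function is real. -/
theorem IsConvolution.im_eq_zero {W : 𝓢'(ℝ, ℂ)} {f : ℝ → ℝ} {g : ℝ → ℂ}
    (H : IsConvolution W (fun x => (f x : ℂ)) g) (hW : IsRealValued W) :
    ∀ᵐ x, (g x).im = 0 := by
  have hgl := locallyIntegrable_of_memLp_two H.2.1
  have hgi : LocallyIntegrable (fun x => (g x).im) := by
    refine hgl.mono (Complex.continuous_im.comp_aestronglyMeasurable H.2.1.1)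
      (Eventually.of_forall fun x => ?_)
    exact Complex.abs_im_le_norm _
  refine ae_eq_zero_of_integral_contDiff_smul_eq_zero hgi fun φ hφ hφc => ?_
  have hc : HasCompactSupport (fun x => (φ x : ℂ)) := hφc.comp_left (g := ((↑) : ℝ → ℂ)) rfl
  have hs : ContDiff ℝ ∞ (fun x => (φ x : ℂ)) := Complex.ofRealCLM.contDiff.comp hφ
  set Φ : 𝓢(ℝ, ℂ) := hc.toSchwartzMap hs with hΦ
  have hΦx : ∀ x, Φ x = (φ x : ℂ) := fun x => by simp [hΦ, HasCompactSupport.toSchwartzMap_toFun]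
  obtain ⟨hi, he⟩ := H.2.2 Φ
  have h1 : ∀ x, φ x • (g x).im = (g x * Φ x).im := fun x => by
    rw [hΦx]; simp [mul_comm]
  have hgΦ : Integrable (fun x => g x * Φ x) := integrable_mul_of_memLp_two H.2.1 (Φ.memLp 2)
  have h2 : ∫ x, (g x * Φ x).im = (∫ x, g x * Φ x).im :=
    Complex.imCLM.integral_comp_comm hgΦ
  have h3 : ∫ x, ((f x : ℂ) * W (SchwartzMap.compSubConstCLM ℂ (-x) Φ)).im =
      (∫ x, (f x : ℂ) * W (SchwartzMap.compSubConstCLM ℂ (-x) Φ)).im :=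
    Complex.imCLM.integral_comp_comm hi
  simp only [h1]
  rw [h2, he, ← h3]
  refine integral_eq_zero_of_ae (Eventually.of_forall fun x => ?_)
  have := hW (SchwartzMap.compSubConstCLM ℂ (-x) Φ) fun y => by
    rw [SchwartzMap.compSubConstCLM_apply, hΦx, Complex.ofReal_im]
  simp [this]

/-! ### Smoothness of traveling waves -/

theorem ofReal_eta (v : ℝ → ℂ) (x : ℝ) : (eta v x : ℂ) = 1 - (starRingEnd ℂ) (v x) * v x := by
  rw [Complex.conj_mul', eta]
  push_cast
  rfl

theorem hasDerivAt_ofReal_eta {v : ℝ → ℂ} (hv : Differentiable ℝ v) (x : ℝ) :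
    HasDerivAt (fun x => (eta v x : ℂ))
      (-((starRingEnd ℂ) (v x) * deriv v x + v x * (starRingEnd ℂ) (deriv v x))) x := by
  have h1 := (hv x).hasDerivAt
  have h2 : HasDerivAt (fun x => (starRingEnd ℂ) (v x)) ((starRingEnd ℂ) (deriv v x)) x := h1.star
  have h3 := (h2.mul h1).const_sub 1
  simp only [ofReal_eta]
  exact h3.congr_deriv (by ring)

theorem reg_ofReal_eta {v : ℝ → ℂ} {n : ℕ} (hv : Differentiable ℝ v) (hvt : Reg ∞ n v)
    (hv' : Reg 2 n (deriv v)) (hη : MemLp (fun x => (eta v x : ℂ)) 2) :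
    Reg 2 (n + 1) (fun x => (eta v x : ℂ)) := by
  refine ⟨fun x => (hasDerivAt_ofReal_eta hv x).differentiableAt, hη, ?_⟩
  rw [show deriv (fun x => (eta v x : ℂ)) = fun x => (-1 : ℂ) * ((starRingEnd ℂ) (v x) * deriv v x +
    v x * (starRingEnd ℂ) (deriv v x)) from funext fun x => by
      rw [(hasDerivAt_ofReal_eta hv x).deriv]; ring]
  exact ((hvt.conj.mul hv').add (hvt.mul hv'.conj)).const_mul _

/-- `v` is a smooth traveling wave and `g` is the smooth real function `W * (1 - |v|²)`. -/
structure IsSmoothWave (W : 𝓢'(ℝ, ℂ)) (c : ℝ) (v g : ℝ → ℂ) : Prop where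
  reg : ∀ n, Reg ∞ n v
  reg_deriv : ∀ n, Reg 2 n (deriv v)
  reg_conv : ∀ n, Reg 2 n g
  reg_eta : ∀ n, Reg 2 n (fun x => (eta v x : ℂ))
  conv : IsConvolution W (fun x => (eta v x : ℂ)) g
  conj_conv : ∀ x, (starRingEnd ℂ) (g x) = g x
  hasDerivAt_deriv : ∀ x, HasDerivAt (deriv v) (-(Complex.I * c * deriv v x) - v x * g x) x

theorem IsConvolution.congr_right {W : 𝓢'(ℝ, ℂ)} {f g g' : ℝ → ℂ} (h : IsConvolution W f g)
    (hg : g =ᵐ[volume] g') : IsConvolution W f g' := by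
  refine ⟨h.1, h.2.1.ae_eq hg, fun φ => ⟨(h.2.2 φ).1, ?_⟩⟩
  rw [← (h.2.2 φ).2]
  exact integral_congr_ae (hg.mono fun x hx => by simp only [hx])

/-- Finite energy traveling waves are smooth: each derivative of `η` in `L²` passes to `W * η`,
and from there the equation gives one more derivative of `u`. -/
theorem exists_isSmoothWave {W : 𝓢'(ℝ, ℂ)} (hW : IsPotential W) {c : ℝ} {u : ℝ → ℂ}
    (hu : InEnergySpace u) (hsol : IsTravelingWave W c u) :
    ∃ v g, u =ᵐ[volume] v ∧ IsSmoothWave W c v g := by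
  obtain ⟨hreal, -, w, hw, hwb⟩ := hW
  obtain ⟨v, g₁, C, huv, hd, hdc, hd2, hvt, hconv₁, heq₁⟩ := exists_C1_representative hu hsol
  have hη : MemLp (fun x => (eta v x : ℂ)) 2 := hconv₁.1
  have hη1 : Reg 2 1 (fun x => (eta v x : ℂ)) :=
    reg_ofReal_eta hd ⟨hd.continuous, hvt⟩ ⟨hdc, hd2⟩ hη
  obtain ⟨g, hgg, hg0⟩ := hconv₁.exists_reg hw hwb hη1
  have hconv := hconv₁.congr_right hgg
  have hder : ∀ x, HasDerivAt (deriv v) (-(Complex.I * c * deriv v x) - v x * g x) x := by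
    intro x
    have hvg : Continuous (fun x => v x * g x) := hd.continuous.mul hg0.continuous
    have h1 : ∀ y, deriv v y = C - (∫ t in (0 : ℝ)..y, v t * g t) - Complex.I * c * v y := by
      intro y
      rw [heq₁, intervalIntegral.integral_congr_ae (hgg.mono fun t ht _ =>
        show v t * g₁ t = v t * g t by rw [ht])]
    have h2 := ((intervalIntegral.integral_hasDerivAt_right (hvg.intervalIntegrable 0 x)
      hvg.stronglyMeasurable.stronglyMeasurableAtFilter hvg.continuousAt).const_sub C).sub
      ((hd x).hasDerivAt.const_mul (Complex.I * c))
    refine (h2.congr_of_eventuallyEq (Eventually.of_forall h1)).congr_deriv ?_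
    ring
  have hderiv : deriv (deriv v) = fun x => (-(Complex.I * c)) * deriv v x + (-1) * (v x * g x) :=
    funext fun x => by rw [(hder x).deriv]; ring
  have key : ∀ n, Reg 2 n g ∧ Reg ∞ n v ∧ Reg 2 n (deriv v) := by
    intro n
    induction n with
    | zero => exact ⟨hg0, ⟨hd.continuous, hvt⟩, ⟨hdc, hd2⟩⟩
    | succ n ih =>
      obtain ⟨ihg, ihv, ihv'⟩ := ih
      have h1 : Reg 2 (n + 1) (deriv v) := by
        refine ⟨fun x => (hder x).differentiableAt, hd2, ?_⟩
        rw [hderiv]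
        exact (ihv'.const_mul _).add ((ihv.mul ihg).const_mul _)
      have h2 : Reg ∞ (n + 1) v := ⟨hd, hvt, h1.top⟩
      obtain ⟨g₂, hg₂, hr₂⟩ := hconv.exists_reg hw hwb (reg_ofReal_eta hd h2 h1 hη)
      have : g = g₂ := (hg0.continuous.ae_eq_iff_eq volume hr₂.continuous).1 hg₂
      exact ⟨this ▸ hr₂, h2, h1⟩
  have him : ∀ x, (g x).im = 0 := by
    have h1 : (fun x => (g x).im) =ᵐ[volume] fun _ => 0 := hconv.im_eq_zero hreal
    exact fun x => congrFun (((Complex.continuous_im.comp hg0.continuous).ae_eq_iff_eq volume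
      continuous_const).1 h1) x
  exact ⟨v, g, huv, fun n => (key n).2.1, fun n => (key n).2.2, fun n => (key n).1,
    fun n => (reg_ofReal_eta hd (key n).2.1 (key n).2.2 hη).of_succ, hconv,
    fun x => Complex.conj_eq_iff_im.2 (him x), hder⟩

/-! ### The equation satisfied by the density -/

namespace IsSmoothWave

variable {W : 𝓢'(ℝ, ℂ)} {c : ℝ} {v g : ℝ → ℂ}

theorem differentiable (H : IsSmoothWave W c v g) : Differentiable ℝ v := (H.reg 1).1

theorem hasDerivAt_conj_mul_deriv (H : IsSmoothWave W c v g) (x : ℝ) :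
    HasDerivAt (fun x => (starRingEnd ℂ) (v x) * deriv v x)
      ((starRingEnd ℂ) (deriv v x) * deriv v x - Complex.I * c * ((starRingEnd ℂ) (v x) * deriv v x)
        - (1 - eta v x) * g x) x := by
  have h1 := (H.differentiable x).hasDerivAt
  have h2 : HasDerivAt (fun x => (starRingEnd ℂ) (v x)) ((starRingEnd ℂ) (deriv v x)) x := h1.star
  refine (h2.mul (H.hasDerivAt_deriv x)).congr_deriv ?_
  rw [ofReal_eta]
  ring

theorem hasDerivAt_mul_conj_deriv (H : IsSmoothWave W c v g) (x : ℝ) :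
    HasDerivAt (fun x => v x * (starRingEnd ℂ) (deriv v x))
      ((starRingEnd ℂ) (deriv v x) * deriv v x + Complex.I * c * (v x * (starRingEnd ℂ) (deriv v x))
        - (1 - eta v x) * g x) x := by
  have h : HasDerivAt (fun x => (starRingEnd ℂ) ((starRingEnd ℂ) (v x) * deriv v x)) _ x :=
    (H.hasDerivAt_conj_mul_deriv x).star
  have e : (fun x => (starRingEnd ℂ) ((starRingEnd ℂ) (v x) * deriv v x)) =
      fun x => v x * (starRingEnd ℂ) (deriv v x) := by
    ext x; simp
  rw [e] at h
  refine h.congr_deriv ?_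
  change (starRingEnd ℂ) _ = _
  simp only [map_sub, map_mul, Complex.conj_conj, Complex.conj_I, Complex.conj_ofReal, map_one,
    H.conj_conv]
  ring

/-- The momentum identity `2 Im (v̄ v') = c η`. -/
theorem momentum (H : IsSmoothWave W c v g) (x : ℝ) :
    (starRingEnd ℂ) (v x) * deriv v x - v x * (starRingEnd ℂ) (deriv v x) =
      Complex.I * c * eta v x := by
  set D : ℝ → ℂ := fun x => (starRingEnd ℂ) (v x) * deriv v x - v x * (starRingEnd ℂ) (deriv v x)
    - Complex.I * c * eta v x with hD
  have hder : ∀ x, HasDerivAt D 0 x := fun x => by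
    refine (((H.hasDerivAt_conj_mul_deriv x).sub (H.hasDerivAt_mul_conj_deriv x)).sub
      ((hasDerivAt_ofReal_eta H.differentiable x).const_mul (Complex.I * c))).congr_deriv ?_
    ring
  have hreg : Reg 2 1 D := by
    have h := ((((H.reg 1).conj.mul (H.reg_deriv 1)).add
      (((H.reg 1).mul (H.reg_deriv 1).conj).const_mul (-1))).add
      ((H.reg_eta 1).const_mul (-(Complex.I * c))))
    have e : D = fun x => (starRingEnd ℂ) (v x) * deriv v x +
        (-1) * (v x * (starRingEnd ℂ) (deriv v x)) + (-(Complex.I * c)) * eta v x := by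
      ext x; simp only [hD]; ring
    rw [e]
    exact h
  have hconst : ∀ y, D y = D x := fun y =>
    is_const_of_deriv_eq_zero hreg.1 (fun z => (hder z).deriv) y x
  have hlim := hreg.tendsto_cocompact
  rw [show D = fun _ => D x from funext hconst] at hlim
  exact sub_eq_zero.1 (tendsto_nhds_unique tendsto_const_nhds hlim)

/-- Twice the real and imaginary parts of `v̄ v'` are `-η'` and `c η`. -/
theorem two_mul_conj_mul_deriv (H : IsSmoothWave W c v g) (x : ℝ) :
    2 * ((starRingEnd ℂ) (v x) * deriv v x) =
      -deriv (fun x => (eta v x : ℂ)) x + Complex.I * c * eta v x := by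
  rw [(hasDerivAt_ofReal_eta H.differentiable x).deriv, ← H.momentum x]
  ring

/-- The quadratic nonlinearity `2 |v'|² + 2 η (W * η)` in the equation for the density `η`. -/
noncomputable def source (v g : ℝ → ℂ) (x : ℝ) : ℂ :=
  2 * ((starRingEnd ℂ) (deriv v x) * deriv v x) + 2 * (eta v x * g x)

/-- The density solves `-η'' - c² η + 2 W * η = 2 |v'|² + 2 η (W * η)`. -/
theorem source_eq (H : IsSmoothWave W c v g) (x : ℝ) :
    source v g x = (-1) * deriv (deriv (fun x => (eta v x : ℂ))) x
      + (-(c : ℂ) ^ 2) * eta v x + 2 * g x := by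
  have e : deriv (fun x => (eta v x : ℂ)) =
      fun x => -((starRingEnd ℂ) (v x) * deriv v x + v x * (starRingEnd ℂ) (deriv v x)) :=
    funext fun x => (hasDerivAt_ofReal_eta H.differentiable x).deriv
  have h := ((H.hasDerivAt_conj_mul_deriv x).add (H.hasDerivAt_mul_conj_deriv x)).neg.deriv
  have h' : deriv (fun x => -((starRingEnd ℂ) (v x) * deriv v x +
      v x * (starRingEnd ℂ) (deriv v x))) x = _ := h
  rw [e, h', source]
  have hm := H.momentum x
  linear_combination (Complex.I * c) * hm + (c : ℂ) ^ 2 * eta v x * Complex.I_sq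

theorem reg_source (H : IsSmoothWave W c v g) (n : ℕ) : Reg 2 n (source v g) :=
  (((H.reg_deriv (n + 1)).top.conj.mul (H.reg_deriv n)).const_mul 2).add
    (((H.reg_eta (n + 1)).top.mul (H.reg_conv n)).const_mul 2)

theorem integrable_source (H : IsSmoothWave W c v g) : Integrable (source v g) :=
  ((integrable_mul_of_memLp_two (H.reg_deriv 0).memLp.star (H.reg_deriv 0).memLp).const_mul 2).add
    ((integrable_mul_of_memLp_two (H.reg_eta 0).memLp (H.reg_conv 0).memLp).const_mul 2)

/-- On the Fourier side the equation for the density reads `M_c η̂ = F̂`. -/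
theorem symbol_mul_eq (H : IsSmoothWave W c v g) {w h : ℝ → ℂ} (hw : HasFourierTransform W w)
    (hwb : MemLp w ∞) (hh : IsFourierPair (fun x => (eta v x : ℂ)) h) :
    (fun ξ : ℝ => symbol w c (2 * Real.pi * ξ) * h ξ) =ᵐ[volume] 𝓕 (source v g) := by
  have h1 := hh.deriv (H.reg_eta 1).1 (H.reg_eta 1).2.2.memLp
  have h2 := h1.deriv (H.reg_eta 2).2.2.1 (H.reg_eta 2).2.2.2.2.memLp
  have h3 := ((h2.const_mul (-1)).add (hh.const_mul (-(c : ℂ) ^ 2))).add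
    ((H.conv.isFourierPair hw hwb hh).const_mul 2)
  have h4 := IsFourierPair.fourier (H.reg_source 0).memLp H.integrable_source
  have e : source v g = fun x => (-1) * deriv (deriv (fun x => (eta v x : ℂ))) x
      + (-(c : ℂ) ^ 2) * eta v x + 2 * g x := funext H.source_eq
  rw [← e] at h3
  refine EventuallyEq.trans (Eventually.of_forall fun ξ => ?_) (h3.right_ae_eq h4)
  simp only [symbol]
  push_cast
  linear_combination (4 * (Real.pi : ℂ) ^ 2 * ξ ^ 2 * h ξ) * Complex.I_sq

end IsSmoothWave

/-! ### The convolution equation for the density -/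

/-- Local integrability is seen by testing against bump functions, which are equal to one near a
given point. -/
theorem locallyIntegrable_of_integrable_mul_schwartz {g : ℝ → ℂ}
    (h : ∀ φ : 𝓢(ℝ, ℂ), Integrable (fun x => g x * φ x)) : LocallyIntegrable g := by
  intro x
  obtain ⟨b⟩ : Nonempty (ContDiffBump x) := inferInstance
  have hc : HasCompactSupport (fun y => (b y : ℂ)) :=
    b.hasCompactSupport.comp_left (g := ((↑) : ℝ → ℂ)) rfl
  have hs : ContDiff ℝ ∞ (fun y => (b y : ℂ)) := Complex.ofRealCLM.contDiff.comp b.contDiff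
  refine ⟨Metric.closedBall x b.rIn, Metric.closedBall_mem_nhds x b.rIn_pos, ?_⟩
  refine ((h (hc.toSchwartzMap hs)).integrableOn (s := Metric.closedBall x b.rIn)).congr_fun
    (fun y hy => ?_) Metric.isClosed_closedBall.measurableSet
  simp [HasCompactSupport.toSchwartzMap_toFun, b.one_of_mem_closedBall hy]

theorem HasFourierTransform.ae_eq {T : 𝓢'(ℝ, ℂ)} {g g' : ℝ → ℂ} (h : HasFourierTransform T g)
    (h' : HasFourierTransform T g') : g =ᵐ[volume] g' :=
  ae_eq_of_integral_mul_schwartz_eq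
    (locallyIntegrable_of_integrable_mul_schwartz fun φ => (h φ).1)
    (locallyIntegrable_of_integrable_mul_schwartz fun φ => (h' φ).1)
    fun φ => by rw [← (h φ).2, (h' φ).2]

/-- An integrable kernel `κ` with `κ̂ = 1 / M_c` inverts the symbol almost everywhere. -/
theorem IsKernel.symbol_mul_fourier {W L : 𝓢'(ℝ, ℂ)} {c : ℝ} {κ : ℝ → ℂ} (hL : IsKernel W c L)
    (hW : IsPotential W) (hκ : IsFunction L κ) (hκi : Integrable κ) :
    ∃ w, HasFourierTransform W w ∧ MemLp w ∞ ∧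
      ∀ᵐ ξ : ℝ, symbol w c (2 * Real.pi * ξ) * 𝓕 κ ξ = 1 := by
  obtain ⟨w, hw, hne, hLw⟩ := hL
  obtain ⟨-, -, w', hw', hwb'⟩ := hW
  refine ⟨w, hw, hwb'.ae_eq (hw'.ae_eq hw), ?_⟩
  have h1 : (fun ξ : ℝ => 1 / symbol w c (2 * Real.pi * ξ)) =ᵐ[volume] 𝓕 κ := by
    refine ae_eq_of_integral_mul_schwartz_eq
      (locallyIntegrable_of_integrable_mul_schwartz fun φ => (hLw.apply_fourier φ).1)
      (continuous_fourier hκi).locallyIntegrable fun φ => ?_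
    rw [← (hLw.apply_fourier φ).2, (hκ (𝓕 φ)).2]
    exact integral_mul_fourier hκi φ.integrable
  have h2 : ∀ᵐ ξ : ℝ, symbol w c (2 * Real.pi * ξ) ≠ 0 :=
    (quasiMeasurePreserving_const_mul (by positivity : 2 * Real.pi ≠ 0)).ae hne
  filter_upwards [h1, h2] with ξ h1 h2
  rw [← h1]
  field_simp

theorem hasDerivAt_integral_mul_comp_sub {κ F : ℝ → ℂ} (hκ : Integrable κ) (hF : Reg ∞ 1 F)
    (x : ℝ) : HasDerivAt (fun x => ∫ y, κ y * F (x - y)) (∫ y, κ y * deriv F (x - y)) x := by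
  obtain ⟨B, hB⟩ := hF.exists_bound
  obtain ⟨B', hB'⟩ := hF.2.2.exists_bound
  have hFc := hF.continuous
  have hFc' := hF.2.2.continuous
  have hmeas : ∀ {G : ℝ → ℂ}, Continuous G → ∀ z,
      AEStronglyMeasurable (fun y => κ y * G (z - y)) volume := fun hG z =>
    hκ.1.mul (hG.comp (continuous_const.sub continuous_id)).aestronglyMeasurable
  refine (hasDerivAt_integral_of_dominated_loc_of_deriv_le (F := fun x y => κ y * F (x - y))
    (F' := fun x y => κ y * deriv F (x - y)) (bound := fun y => ‖κ y‖ * B') (s := Set.univ)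
    univ_mem (Eventually.of_forall fun z => hmeas hFc z) ?_ (hmeas hFc' x)
    (Eventually.of_forall fun y z _ => ?_) (hκ.norm.mul_const B')
    (Eventually.of_forall fun y z _ => ?_)).2
  · refine (hκ.norm.mul_const B).mono' (hmeas hFc x) (Eventually.of_forall fun y => ?_)
    rw [norm_mul]
    exact mul_le_mul_of_nonneg_left (hB _) (norm_nonneg _)
  · rw [norm_mul]
    exact mul_le_mul_of_nonneg_left (hB' _) (norm_nonneg _)
  · have h1 : HasDerivAt (fun z => F (z - y)) (deriv F (z - y)) z :=
      (hF.1 (z - y)).hasDerivAt.comp_sub_const z y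
    exact h1.const_mul (κ y)

namespace IsSmoothWave

variable {W : 𝓢'(ℝ, ℂ)} {c : ℝ} {v g : ℝ → ℂ}

/-- Inverting the symbol turns the equation for the density into `η = κ * F`. -/
theorem eta_eq_integral (H : IsSmoothWave W c v g) {L : 𝓢'(ℝ, ℂ)} {κ : ℝ → ℂ}
    (hW : IsPotential W) (hL : IsKernel W c L) (hκ : IsFunction L κ) (hκi : Integrable κ) :
    (fun x => (eta v x : ℂ)) = fun x => ∫ y, κ y * source v g (x - y) := by
  obtain ⟨w, hw, hwb, hsymb⟩ := hL.symbol_mul_fourier hW hκ hκi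
  obtain ⟨h, hh⟩ := IsFourierPair.exists_right (H.reg_eta 0).memLp
  have hhF : h =ᵐ[volume] fun ξ => 𝓕 κ ξ * 𝓕 (source v g) ξ := by
    filter_upwards [hsymb, H.symbol_mul_eq hw hwb hh] with ξ h1 h2
    rw [← h2]
    linear_combination -h ξ * h1
  have hFi := H.integrable_source
  have hFr : Reg ∞ 1 (source v g) := (H.reg_source 2).top
  set q : ℝ → ℂ := convolution κ (source v g) (ContinuousLinearMap.mul ℂ ℂ) volume with hq
  have hqe : q = fun x => ∫ y, κ y * source v g (x - y) := by
    ext x; simp [hq, convolution_def]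
  have hqi : Integrable q := hκi.integrable_convolution _ hFi
  have hqc : Continuous q := by
    rw [hqe]
    exact continuous_iff_continuousAt.2 fun x =>
      (hasDerivAt_integral_mul_comp_sub hκi hFr x).continuousAt
  rw [← hqe]
  refine ((H.reg_eta 0).continuous.ae_eq_iff_eq volume hqc).1
    (hh.left_ae_eq_of_integral hqc.locallyIntegrable fun ψ => ?_)
  rw [SchwartzMap.fourier_coe, integral_mul_fourier hqi ψ.integrable]
  refine integral_congr_ae (hhF.mono fun ξ hξ => ?_)
  simp only [hξ, hq]
  rw [Real.fourier_mul_convolution_eq hκi hFi]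

/-- The derivative falls on the source, so no regularity of the kernel is used. -/
theorem deriv_eta_eq_integral (H : IsSmoothWave W c v g) {L : 𝓢'(ℝ, ℂ)} {κ : ℝ → ℂ}
    (hW : IsPotential W) (hL : IsKernel W c L) (hκ : IsFunction L κ) (hκi : Integrable κ) (x : ℝ) :
    deriv (fun x => (eta v x : ℂ)) x = ∫ y, κ y * deriv (source v g) (x - y) := by
  rw [H.eta_eq_integral hW hL hκ hκi]
  exact (hasDerivAt_integral_mul_comp_sub hκi (H.reg_source 2).top x).deriv

end IsSmoothWave

/-! ### Exponential decay from a convolution inequality -/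

/-- `f(x) = O(e^{-a|x|})` on the whole line. -/
def ExpDecay (a : ℝ) (f : ℝ → ℝ) : Prop :=
  ∃ C, ∀ x, |f x| ≤ C * Real.exp (-(a * |x|))

/-- If `h ≤ k * G` for an exponentially integrable kernel `k`, and `G` is negligible with respect
to `h` at infinity, then `h` decays exponentially. The estimate is run with the bounded weights
`e^{a min(|x|, N)}`, for which the weighted supremum of `h` is finite, and is uniform in `N`. -/
theorem expDecay_of_le_integral {h G k : ℝ → ℝ} {a B D : ℝ} (ha : 0 ≤ a) (hk : ∀ y, 0 ≤ k y)
    (hki : Integrable fun y => Real.exp (a * |y|) * k y) (hh : ∀ x, 0 ≤ h x) (hB : ∀ x, h x ≤ B)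
    (hG : ∀ x, 0 ≤ G x) (hD : ∀ x, G x ≤ D) (hle : ∀ x, h x ≤ ∫ y, k y * G (x - y))
    (hsmall : ∀ ε > 0, ∀ᶠ x in cocompact ℝ, G x ≤ ε * h x) : ExpDecay a h := by
  set K : ℝ := ∫ y, Real.exp (a * |y|) * k y with hK
  have hK0 : 0 ≤ K := integral_nonneg fun y => mul_nonneg (Real.exp_pos _).le (hk y)
  -- The smallness of `G` is used with a constant which makes the estimate contract by one half.
  set ε : ℝ := 1 / (2 * (K + 1)) with hε
  have hε0 : 0 < ε := by positivity
  have hKε : K * ε ≤ 1 / 2 := by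
    rw [hε, mul_one_div, div_le_div_iff₀ (by positivity) (by norm_num)]
    linarith
  obtain ⟨R, hR⟩ : ∃ R : ℝ, ∀ x, R < |x| → G x ≤ ε * h x := by
    have h1 := hsmall ε hε0
    rw [← Metric.cobounded_eq_cocompact, ← comap_norm_atTop,
      (atTop_basis_Ioi.comap _).eventually_iff] at h1
    obtain ⟨R, -, hR⟩ := h1
    exact ⟨R, fun x hx => hR hx⟩
  have hD0 : 0 ≤ D := (hG 0).trans (hD 0)
  set M : ℝ := D * Real.exp (a * |R|) with hM
  have hM0 : 0 ≤ M := by positivity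
  have main : ∀ N : ℝ, 0 ≤ N → ∀ x, Real.exp (a * min |x| N) * h x ≤ 2 * (K * M) := by
    intro N hN
    set ρ : ℝ → ℝ := fun x => Real.exp (a * min |x| N) with hρ
    have hbdd : BddAbove (Set.range fun x => ρ x * h x) := by
      refine ⟨Real.exp (a * N) * B, ?_⟩
      rintro _ ⟨x, rfl⟩
      exact mul_le_mul (Real.exp_le_exp.2 (mul_le_mul_of_nonneg_left (min_le_right _ _) ha))
        (hB x) (hh x) (Real.exp_pos _).le
    set S : ℝ := ⨆ x, ρ x * h x with hS
    have hS1 : ∀ x, ρ x * h x ≤ S := le_ciSup hbdd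
    have hS0 : 0 ≤ S := (mul_nonneg (Real.exp_pos _).le (hh 0)).trans (hS1 0)
    have hGS : ∀ z, ρ z * G z ≤ ε * S + M := by
      intro z
      by_cases hz : R < |z|
      · have h1 := mul_le_mul_of_nonneg_left (hR z hz) (Real.exp_pos (a * min |z| N)).le
        have h2 := mul_le_mul_of_nonneg_left (hS1 z) hε0.le
        simp only [hρ] at h2 ⊢
        linarith
      · have h1 : ρ z ≤ Real.exp (a * |R|) := Real.exp_le_exp.2 (mul_le_mul_of_nonneg_left
          ((min_le_left _ _).trans ((not_lt.1 hz).trans (le_abs_self R))) ha)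
        have h2 := mul_le_mul h1 (hD z) (hG z) (Real.exp_pos _).le
        have h3 := mul_nonneg hε0.le hS0
        rw [hM]; linarith
    have hρsub : ∀ x y, ρ x ≤ Real.exp (a * |y|) * ρ (x - y) := by
      intro x y
      rw [hρ, ← Real.exp_add, Real.exp_le_exp, ← mul_add]
      refine mul_le_mul_of_nonneg_left ?_ ha
      have h1 : |x| ≤ |y| + |x - y| := by
        simpa [add_comm] using abs_add_le (x - y) y
      have h2 := abs_nonneg y
      rcases min_cases |x - y| N with ⟨e, _⟩ | ⟨e, _⟩
      · rw [e]; exact (min_le_left _ _).trans h1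
      · rw [e]; exact (min_le_right _ _).trans (by linarith)
    have hstep : ∀ x, ρ x * h x ≤ K * (ε * S + M) := by
      intro x
      calc ρ x * h x ≤ ρ x * ∫ y, k y * G (x - y) :=
            mul_le_mul_of_nonneg_left (hle x) (Real.exp_pos _).le
        _ = ∫ y, ρ x * (k y * G (x - y)) := (integral_const_mul _ _).symm
        _ ≤ ∫ y, Real.exp (a * |y|) * k y * (ε * S + M) := by
            refine integral_mono_of_nonneg (Eventually.of_forall fun y =>
              mul_nonneg (Real.exp_pos _).le (mul_nonneg (hk y) (hG _))) (hki.mul_const _)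
              (Eventually.of_forall fun y => ?_)
            have h1 := mul_le_mul_of_nonneg_right (hρsub x y) (mul_nonneg (hk y) (hG (x - y)))
            have h2 := mul_le_mul_of_nonneg_left (hGS (x - y))
              (mul_nonneg (Real.exp_pos (a * |y|)).le (hk y))
            refine h1.trans (le_of_eq_of_le ?_ h2)
            ring
        _ = K * (ε * S + M) := integral_mul_const _ _
    have hSle : S ≤ K * (ε * S + M) := ciSup_le hstep
    have h1 : K * ε * S ≤ 1 / 2 * S := mul_le_mul_of_nonneg_right hKε hS0
    intro x
    refine (hS1 x).trans ?_
    nlinarith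
  refine ⟨2 * (K * M), fun x => ?_⟩
  have h1 := main |x| (abs_nonneg x) x
  rw [min_self] at h1
  rw [abs_of_nonneg (hh x), Real.exp_neg, ← div_eq_mul_inv, le_div_iff₀ (Real.exp_pos _)]
  linarith

/-! ### Exponential decay of derivatives -/

namespace ExpDecay

variable {a b : ℝ} {f : ℝ → ℝ}

theorem exists_nonneg (h : ExpDecay a f) : ∃ C ≥ 0, ∀ x, |f x| ≤ C * Real.exp (-(a * |x|)) := by
  obtain ⟨C, hC⟩ := h
  refine ⟨C, ?_, hC⟩
  have := (abs_nonneg _).trans (hC 0)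
  simpa using this

theorem mono (h : ExpDecay a f) (hb : b ≤ a) : ExpDecay b f := by
  obtain ⟨C, hC0, hC⟩ := h.exists_nonneg
  refine ⟨C, fun x => (hC x).trans (mul_le_mul_of_nonneg_left (Real.exp_le_exp.2 ?_) hC0)⟩
  have := mul_le_mul_of_nonneg_right hb (abs_nonneg x)
  linarith

theorem of_abs_le {f' : ℝ → ℝ} (h : ExpDecay a f) (hf : ∀ x, |f' x| ≤ |f x|) : ExpDecay a f' := by
  obtain ⟨C, hC⟩ := h
  exact ⟨C, fun x => (hf x).trans (hC x)⟩

/-- Changing the point by at most one changes an exponential bound by a constant factor. -/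
theorem exists_translate (h : ExpDecay a f) (ha : 0 ≤ a) :
    ∃ C ≥ 0, ∀ x y, |y - x| ≤ 1 → |f y| ≤ C * Real.exp (-(a * |x|)) := by
  obtain ⟨C, hC0, hC⟩ := h.exists_nonneg
  refine ⟨C * Real.exp a, by positivity, fun x y hy => (hC y).trans ?_⟩
  rw [mul_assoc, ← Real.exp_add]
  refine mul_le_mul_of_nonneg_left (Real.exp_le_exp.2 ?_) hC0
  have h1 : |x| ≤ |y| + 1 := by
    have := abs_sub_abs_le_abs_sub x y
    rw [abs_sub_comm] at this
    linarith
  nlinarith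

/-- Landau–Kolmogorov interpolation: the first derivative decays at the mean of the rates of the
function and of its second derivative. -/
theorem deriv_of_deriv_deriv (h : ExpDecay a f) (h2 : ExpDecay b (deriv (deriv f))) (hb : 0 ≤ b)
    (hba : b ≤ a) (hf : Differentiable ℝ f) (hf' : Differentiable ℝ (deriv f)) :
    ExpDecay ((a + b) / 2) (deriv f) := by
  obtain ⟨C, hC0, hC⟩ := h.exists_translate (hb.trans hba)
  obtain ⟨C', hC'0, hC'⟩ := h2.exists_translate hb
  refine ⟨2 * C + C', fun x => ?_⟩
  -- The step of the difference quotient which balances its two error terms.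
  set s : ℝ := Real.exp (-((a - b) / 2 * |x|)) with hs
  have hs0 : 0 < s := Real.exp_pos _
  have hs1 : s ≤ 1 := Real.exp_le_one_iff.2 (by
    have := mul_nonneg (by linarith : 0 ≤ (a - b) / 2) (abs_nonneg x)
    linarith)
  obtain ⟨ξ, hξ, hξe⟩ := exists_deriv_eq_slope f (by linarith : x < x + s)
    hf.continuous.continuousOn hf.differentiableOn
  obtain ⟨ζ, hζ, hζe⟩ := exists_deriv_eq_slope (deriv f) hξ.1
    hf'.continuous.continuousOn hf'.differentiableOn
  have e1 : Real.exp (-(a * |x|)) = s * Real.exp (-((a + b) / 2 * |x|)) := by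
    rw [hs, ← Real.exp_add]; congr 1; ring
  have e2 : s * Real.exp (-(b * |x|)) = Real.exp (-((a + b) / 2 * |x|)) := by
    rw [hs, ← Real.exp_add]; congr 1; ring
  have b1 : |f (x + s) - f x| ≤ 2 * C * Real.exp (-(a * |x|)) := by
    have h1 := hC x (x + s) (by rw [add_sub_cancel_left, abs_of_pos hs0]; exact hs1)
    have h2 := hC x x (by simp)
    have h3 := abs_sub (f (x + s)) (f x)
    linarith
  have b2 : |deriv f ξ| ≤ 2 * C * Real.exp (-((a + b) / 2 * |x|)) := by
    rw [hξe, add_sub_cancel_left, abs_div, abs_of_pos hs0, div_le_iff₀ hs0]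
    rw [e1] at b1
    linarith
  have b3 : |deriv (deriv f) ζ| ≤ C' * Real.exp (-(b * |x|)) :=
    hC' x ζ (by rw [abs_of_pos (by linarith [hζ.1])]; linarith [hζ.2, hξ.2])
  have b4 : |deriv f ξ - deriv f x| ≤ C' * Real.exp (-((a + b) / 2 * |x|)) := by
    have hne : ξ - x ≠ 0 := (sub_pos.2 hξ.1).ne'
    have h1 : deriv f ξ - deriv f x = deriv (deriv f) ζ * (ξ - x) := by
      rw [hζe]; field_simp
    rw [h1, abs_mul, abs_of_pos (sub_pos.2 hξ.1), ← e2]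
    have h2 : ξ - x ≤ s := by linarith [hξ.2]
    calc |deriv (deriv f) ζ| * (ξ - x) ≤ (C' * Real.exp (-(b * |x|))) * s :=
          mul_le_mul b3 h2 (sub_pos.2 hξ.1).le (by positivity)
      _ = C' * (s * Real.exp (-(b * |x|))) := by ring
  have h5 := abs_sub_abs_le_abs_sub (deriv f x) (deriv f ξ)
  rw [abs_sub_comm] at h5
  linarith

end ExpDecay

/-- Smooth functions all of whose derivatives are bounded. -/
def SmoothBounded (f : ℝ → ℝ) : Prop :=
  ContDiff ℝ ∞ f ∧ ∀ k, ∃ B, ∀ x, |iteratedDeriv k f x| ≤ B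

theorem SmoothBounded.deriv {f : ℝ → ℝ} (h : SmoothBounded f) : SmoothBounded (deriv f) :=
  ⟨(contDiff_infty_iff_deriv.1 h.1).2, fun k => by
    rw [← iteratedDeriv_succ']; exact h.2 (k + 1)⟩

theorem SmoothBounded.differentiable {f : ℝ → ℝ} (h : SmoothBounded f) : Differentiable ℝ f :=
  (contDiff_infty_iff_deriv.1 h.1).1

/-- Iterating the interpolation inequality `n` times, the decay rate of the derivative is a fraction
of that of the function tending to one: from a fraction `θ` one passes to `(1 + θ²) / 2`. -/
theorem SmoothBounded.expDecay_deriv_fraction (n : ℕ) {f : ℝ → ℝ} (h : SmoothBounded f) {a : ℝ}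
    (ha : 0 ≤ a) (hf : ExpDecay a f) : ExpDecay (n / (n + 2) * a) (_root_.deriv f) := by
  induction n generalizing f a with
  | zero =>
    obtain ⟨B, hB⟩ := h.2 1
    exact ⟨B, fun x => by simpa [iteratedDeriv_one] using hB x⟩
  | succ n ih =>
    set θ : ℝ := (n : ℝ) / (n + 2) with hθ
    have hθ0 : 0 ≤ θ := by positivity
    have hθ1 : θ ≤ 1 := by rw [hθ, div_le_one (by positivity)]; linarith
    have h1 : ExpDecay (θ * a) (_root_.deriv f) := ih h ha hf
    have h2 : ExpDecay (θ * (θ * a)) (_root_.deriv (_root_.deriv f)) :=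
      ih h.deriv (by positivity) h1
    have hle : θ * (θ * a) ≤ a := by
      have h3 : θ * θ ≤ 1 := mul_le_one₀ hθ1 hθ0 hθ1
      nlinarith
    refine (hf.deriv_of_deriv_deriv h2 (by positivity) hle h.differentiable
      h.deriv.differentiable).mono ?_
    have h4 : ((n + 1 : ℕ) : ℝ) / ((n + 1 : ℕ) + 2) ≤ (1 + θ * θ) / 2 := by
      have hn : (0 : ℝ) ≤ n := n.cast_nonneg
      rw [hθ, div_mul_div_comm, div_le_iff₀ (by positivity)]
      push_cast
      field_simp
      nlinarith
    calc _ ≤ (1 + θ * θ) / 2 * a := mul_le_mul_of_nonneg_right h4 ha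
      _ = _ := by ring

theorem SmoothBounded.expDecay_deriv {f : ℝ → ℝ} (h : SmoothBounded f) {m : ℝ}
    (hf : ∀ a, 0 ≤ a → a < m → ExpDecay a f) :
    ∀ a, 0 ≤ a → a < m → ExpDecay a (_root_.deriv f) := by
  intro a ha ham
  obtain ⟨a', h1, h2⟩ := exists_between ham
  have ha' : 0 < a' := ha.trans_lt h1
  -- The fraction `n / (n + 2)` of the rate `a'` exceeds `a` once `n (a' - a) > 2 a`.
  obtain ⟨n, hn⟩ := exists_nat_gt (2 * a / (a' - a))
  refine (h.expDecay_deriv_fraction n ha'.le (hf a' ha'.le h2)).mono ?_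
  rw [div_lt_iff₀ (sub_pos.2 h1)] at hn
  rw [div_mul_eq_mul_div, le_div_iff₀ (by positivity)]
  nlinarith

theorem SmoothBounded.expDecay_iteratedDeriv {f : ℝ → ℝ} (h : SmoothBounded f) {m : ℝ}
    (hf : ∀ a, 0 ≤ a → a < m → ExpDecay a f) (k : ℕ) :
    ∀ a, 0 ≤ a → a < m → ExpDecay a (iteratedDeriv k f) := by
  induction k generalizing f with
  | zero => simpa using hf
  | succ k ih => rw [iteratedDeriv_succ']; exact ih h.deriv (h.expDecay_deriv hf)

theorem tendsto_exp_mul_of_expDecay {f : ℝ → ℝ} {ℓ a : ℝ} (hℓ : ℓ < a) (h : ExpDecay a f) :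
    Tendsto (fun x : ℝ => Real.exp (ℓ * |x|) * f x) (cocompact ℝ) (𝓝 0) := by
  obtain ⟨C, hC⟩ := h
  have h1 : Tendsto (fun x : ℝ => C * Real.exp (-((a - ℓ) * |x|))) (cocompact ℝ) (𝓝 0) := by
    have h2 : Tendsto (fun x : ℝ => (a - ℓ) * |x|) (cocompact ℝ) atTop :=
      (tendsto_norm_cocompact_atTop (E := ℝ)).const_mul_atTop (sub_pos.2 hℓ)
    simpa using (Real.tendsto_exp_neg_atTop_nhds_zero.comp h2).const_mul C
  refine squeeze_zero_norm (fun x => ?_) h1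
  rw [Real.norm_eq_abs, abs_mul, abs_of_pos (Real.exp_pos _)]
  calc Real.exp (ℓ * |x|) * |f x| ≤ Real.exp (ℓ * |x|) * (C * Real.exp (-(a * |x|))) :=
        mul_le_mul_of_nonneg_left (hC x) (Real.exp_pos _).le
    _ = C * (Real.exp (ℓ * |x|) * Real.exp (-(a * |x|))) := by ring
    _ = C * Real.exp (-((a - ℓ) * |x|)) := by
        rw [← Real.exp_add]; congr 2; ring

/-! ### Decay of the density -/

theorem integrable_exp_neg_mul_abs {b : ℝ} (hb : 0 < b) :
    Integrable fun x : ℝ => Real.exp (-(b * |x|)) := by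
  rw [← integrableOn_univ, ← Set.Iic_union_Ioi (a := (0 : ℝ))]
  refine IntegrableOn.union ?_ ?_
  · refine (integrableOn_exp_mul_Iic hb 0).congr_fun (fun x hx => ?_) measurableSet_Iic
    simp only [abs_of_nonpos (Set.mem_Iic.1 hx), mul_neg, neg_neg]
  · refine (exp_neg_integrableOn_Ioi 0 hb).congr_fun (fun x hx => ?_) measurableSet_Ioi
    simp only [abs_of_pos (Set.mem_Ioi.1 hx), neg_mul]

theorem memLp_exp_neg_mul_abs {b : ℝ} (hb : 0 < b) {q : ℝ≥0∞} (hq : q ≠ 0) :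
    MemLp (fun x : ℝ => Real.exp (-(b * |x|))) q := by
  have hc : Continuous fun x : ℝ => Real.exp (-(b * |x|)) := by fun_prop
  by_cases hqt : q = ⊤
  · subst hqt
    refine memLp_top_of_bound hc.aestronglyMeasurable 1 (Eventually.of_forall fun x => ?_)
    rw [Real.norm_eq_abs, Real.abs_exp, Real.exp_le_one_iff]
    have := mul_nonneg hb.le (abs_nonneg x)
    linarith
  · rw [← integrable_norm_rpow_iff hc.aestronglyMeasurable hq hqt]
    refine (integrable_exp_neg_mul_abs (mul_pos hb (ENNReal.toReal_pos hq hqt))).congr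
      (Eventually.of_forall fun x => ?_)
    beta_reduce
    rw [Real.norm_eq_abs, Real.abs_exp, ← Real.exp_mul]
    congr 1
    ring

/-- An exponentially weighted `L^p` bound gives weighted integrability for every smaller rate, by
Hölder's inequality. -/
theorem integrable_exp_mul_norm {κ : ℝ → ℂ} {m a : ℝ} {p : ℝ≥0∞} (hp : 1 ≤ p) (ha : a < m)
    (h : MemLp (fun x : ℝ => (Real.exp (m * |x|) : ℂ) * κ x) p) :
    Integrable fun x => Real.exp (a * |x|) * ‖κ x‖ := by
  have hconj := ENNReal.HolderConjugate.conjExponent hp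
  have h1 := memLp_exp_neg_mul_abs (sub_pos.2 ha) (q := p.conjExponent) hconj.symm.ne_zero
  refine (h.norm.integrable_mul h1).congr (Eventually.of_forall fun x => ?_)
  simp only [Pi.mul_apply, norm_mul, Complex.norm_real, Real.norm_eq_abs, Real.abs_exp]
  rw [mul_right_comm, ← Real.exp_add]
  congr 2
  ring

theorem iteratedDeriv_re {E : ℝ → ℂ} (hE : ContDiff ℝ ∞ E) (k : ℕ) :
    iteratedDeriv k (fun x => (E x).re) = fun x => (iteratedDeriv k E x).re := by
  induction k generalizing E with
  | zero => simp
  | succ k ih =>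
    obtain ⟨hd, hE'⟩ := contDiff_infty_iff_deriv.1 hE
    rw [iteratedDeriv_succ', iteratedDeriv_succ', ← ih hE']
    congr 1
    ext x
    exact (Complex.reCLM.hasFDerivAt.comp_hasDerivAt x (hd x).hasDerivAt).deriv

namespace IsSmoothWave

variable {W : 𝓢'(ℝ, ℂ)} {c : ℝ} {v g : ℝ → ℂ}

/-- Where `|v|` is not small, the identity `2 v̄ v' = -η' + i c η` controls `v'`. -/
theorem norm_deriv_le (H : IsSmoothWave W c v g) {x : ℝ} (hx : ‖(eta v x : ℂ)‖ ≤ 1 / 2) :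
    ‖deriv v x‖ ≤ (1 + |c|) * (‖(eta v x : ℂ)‖ + ‖deriv (fun x => (eta v x : ℂ)) x‖) := by
  have h1 := congrArg norm (H.two_mul_conj_mul_deriv x)
  have h2 := norm_add_le (-deriv (fun x => (eta v x : ℂ)) x) (Complex.I * c * eta v x)
  rw [← h1] at h2
  simp only [norm_mul, RCLike.norm_conj, norm_neg, Complex.norm_I, Complex.norm_real,
    Complex.norm_ofNat, one_mul, Real.norm_eq_abs] at h2
  rw [Complex.norm_real, Real.norm_eq_abs] at hx ⊢
  have h3 : 1 / 2 ≤ ‖v x‖ := by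
    have h4 := (abs_le.1 hx).2
    rw [eta] at h4
    nlinarith [norm_nonneg (v x)]
  have h5 : ‖deriv v x‖ ≤ 2 * (‖v x‖ * ‖deriv v x‖) := by nlinarith [norm_nonneg (deriv v x)]
  nlinarith [abs_nonneg c, norm_nonneg (deriv (fun x => (eta v x : ℂ)) x), abs_nonneg (eta v x)]

theorem norm_source_le (v g : ℝ → ℂ) (x : ℝ) :
    ‖source v g x‖ ≤ 2 * (‖deriv v x‖ * ‖deriv v x‖) + 2 * (‖(eta v x : ℂ)‖ * ‖g x‖) := by
  refine (norm_add_le _ _).trans (le_of_eq ?_)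
  simp only [norm_mul, RCLike.norm_conj, Complex.norm_ofNat]

theorem norm_deriv_source_le (H : IsSmoothWave W c v g) (x : ℝ) :
    ‖deriv (source v g) x‖ ≤ 4 * (‖deriv (deriv v) x‖ * ‖deriv v x‖) +
      2 * (‖deriv (fun x => (eta v x : ℂ)) x‖ * ‖g x‖ + ‖(eta v x : ℂ)‖ * ‖deriv g x‖) := by
  have h1 := ((H.reg_deriv 1).1 x).hasDerivAt
  have h2 : HasDerivAt (fun x => (starRingEnd ℂ) (deriv v x))
    ((starRingEnd ℂ) (deriv (deriv v) x)) x := h1.star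
  have h3 := ((H.reg_eta 1).1 x).hasDerivAt
  have h4 := ((H.reg_conv 1).1 x).hasDerivAt
  have h5 : HasDerivAt (source v g) _ x := ((h2.mul h1).const_mul 2).add ((h3.mul h4).const_mul 2)
  rw [h5.deriv]
  refine (norm_add_le _ _).trans (add_le_add ?_ ?_)
  · rw [norm_mul, Complex.norm_ofNat]
    have h6 := norm_add_le ((starRingEnd ℂ) (deriv (deriv v) x) * deriv v x)
      ((starRingEnd ℂ) (deriv v x) * deriv (deriv v) x)
    simp only [norm_mul, RCLike.norm_conj] at h6
    linarith
  · rw [norm_mul, Complex.norm_ofNat, ← norm_mul, ← norm_mul]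
    exact mul_le_mul_of_nonneg_left (norm_add_le _ _) zero_le_two

/-- The nonlinearity and its derivative are negligible at infinity with respect to `|η| + |η'|`:
they are quadratic in quantities tending to zero, and `v'` is controlled by `η` and `η'`. -/
theorem eventually_source_le (H : IsSmoothWave W c v g) {ε : ℝ} (hε : 0 < ε) :
    ∀ᶠ x in cocompact ℝ, ‖source v g x‖ + ‖deriv (source v g) x‖ ≤
      ε * (‖(eta v x : ℂ)‖ + ‖deriv (fun x => (eta v x : ℂ)) x‖) := by
  -- If `v', v'', g, g'` are at most `δ`, the left side is at most `6 δ |v'| + 4 δ (|η| + |η'|)`.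
  set δ : ℝ := ε / (6 * (1 + |c|) + 4) with hδ
  have hδ0 : 0 < δ := by positivity
  have hev : ∀ {f : ℝ → ℂ}, Reg 2 1 f → ∀ r > 0, ∀ᶠ x in cocompact ℝ, ‖f x‖ ≤ r :=
    fun hf r hr => by
      have h := hf.tendsto_cocompact.norm
      rw [norm_zero] at h
      exact (h.eventually (gt_mem_nhds hr)).mono fun x hx => le_of_lt hx
  filter_upwards [hev (H.reg_eta 1) (1 / 2) (by norm_num), hev (H.reg_deriv 1) δ hδ0,
    hev (H.reg_deriv 2).2.2 δ hδ0, hev (H.reg_conv 1) δ hδ0, hev (H.reg_conv 2).2.2 δ hδ0]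
    with x h0 h1 h2 h3 h4
  have hF := norm_source_le v g x
  have hF' := H.norm_deriv_source_le x
  have hv := H.norm_deriv_le h0
  set e := ‖(eta v x : ℂ)‖
  set e' := ‖deriv (fun x => (eta v x : ℂ)) x‖
  set d := ‖deriv v x‖
  have he : 0 ≤ e := norm_nonneg _
  have he' : 0 ≤ e' := norm_nonneg _
  have hd : 0 ≤ d := norm_nonneg _
  have m1 := mul_le_mul_of_nonneg_right h1 hd
  have m2 := mul_le_mul_of_nonneg_right h2 hd
  have m3 := mul_le_mul_of_nonneg_left h3 he
  have m4 := mul_le_mul_of_nonneg_left h3 he'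
  have m5 := mul_le_mul_of_nonneg_left h4 he
  have m6 := mul_le_mul_of_nonneg_left hv hδ0.le
  have hεδ : ε = δ * (6 * (1 + |c|) + 4) := by rw [hδ]; field_simp
  have m7 := mul_nonneg hδ0.le he'
  rw [hεδ]
  nlinarith

/-- The density decays at every rate at which the kernel is integrable. -/
theorem expDecay_eta (H : IsSmoothWave W c v g) {L : 𝓢'(ℝ, ℂ)} {κ : ℝ → ℂ} (hW : IsPotential W)
    (hL : IsKernel W c L) (hκ : IsFunction L κ) (hκm : AEStronglyMeasurable κ) {a : ℝ} (ha : 0 ≤ a)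
    (hκa : Integrable fun x => Real.exp (a * |x|) * ‖κ x‖) : ExpDecay a (eta v) := by
  have hκi : Integrable κ := by
    refine hκa.mono' hκm (Eventually.of_forall fun x => ?_)
    exact le_mul_of_one_le_left (norm_nonneg _)
      (Real.one_le_exp (mul_nonneg ha (abs_nonneg x)))
  obtain ⟨B, hB⟩ := (H.reg_eta 1).top.exists_bound
  obtain ⟨B', hB'⟩ := (H.reg_eta 2).top.2.2.exists_bound
  obtain ⟨D, hD⟩ := (H.reg_source 1).top.exists_bound
  obtain ⟨D', hD'⟩ := (H.reg_source 2).top.2.2.exists_bound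
  have hint : ∀ {G : ℝ → ℂ} {r : ℝ}, Continuous G → (∀ x, ‖G x‖ ≤ r) → ∀ x,
      Integrable fun y => ‖κ y‖ * ‖G (x - y)‖ := fun hG hr x =>
    hκi.norm.mul_bdd (hG.comp (continuous_const.sub continuous_id)).norm.aestronglyMeasurable
      (Eventually.of_forall fun y => by rw [norm_norm]; exact hr _)
  have hnorm : ∀ (G : ℝ → ℂ) (x : ℝ),
      ‖∫ y, κ y * G (x - y)‖ ≤ ∫ y, ‖κ y‖ * ‖G (x - y)‖ := fun G x => by
    simpa only [norm_mul] using norm_integral_le_integral_norm (fun y => κ y * G (x - y))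
  have hmain := expDecay_of_le_integral (k := fun y => ‖κ y‖)
    (h := fun x => ‖(eta v x : ℂ)‖ + ‖deriv (fun x => (eta v x : ℂ)) x‖)
    (G := fun x => ‖source v g x‖ + ‖deriv (source v g) x‖) (B := B + B') (D := D + D') ha
    (fun y => norm_nonneg _) hκa (fun x => by positivity) (fun x => add_le_add (hB x) (hB' x))
    (fun x => by positivity) (fun x => add_le_add (hD x) (hD' x)) (fun x => ?_)
    (fun ε hε => H.eventually_source_le hε)
  · refine hmain.of_abs_le fun x => ?_
    rw [abs_of_nonneg (by positivity : 0 ≤ ‖(eta v x : ℂ)‖ +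
      ‖deriv (fun x => (eta v x : ℂ)) x‖), Complex.norm_real, Real.norm_eq_abs]
    exact le_add_of_nonneg_right (norm_nonneg _)
  · have e1 : (eta v x : ℂ) = ∫ y, κ y * source v g (x - y) :=
      congrFun (H.eta_eq_integral hW hL hκ hκi) x
    have e2 := H.deriv_eta_eq_integral hW hL hκ hκi x
    simp only [mul_add]
    rw [integral_add (hint (H.reg_source 0).continuous hD x)
      (hint (H.reg_source 1).2.2.continuous hD' x), e1, e2]
    exact add_le_add (hnorm _ x) (hnorm _ x)

theorem smoothBounded_eta (H : IsSmoothWave W c v g) : SmoothBounded (eta v) := by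
  have hE : ContDiff ℝ ∞ (fun x => (eta v x : ℂ)) :=
    contDiff_infty.2 fun n => (H.reg_eta n).contDiff
  have e : eta v = fun x => ((eta v x : ℂ)).re := by ext x; simp
  refine ⟨?_, fun k => ?_⟩
  · rw [e]; exact Complex.reCLM.contDiff.comp hE
  · obtain ⟨B, hB⟩ := (H.reg_eta (k + 1)).top.exists_bound_iteratedDeriv
    refine ⟨B, fun x => ?_⟩
    rw [e, iteratedDeriv_re hE]
    exact (Complex.abs_re_le_norm _).trans (hB x)

end IsSmoothWave

end NonlocalGP

theorem theorem3
    (W : 𝓢'(ℝ, ℂ)) (hW : NonlocalGP.IsPotential W)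
    (c : ℝ) (hc : 0 ≤ c)
    (u : ℝ → ℂ) (hu : NonlocalGP.InEnergySpace u) (hsol : NonlocalGP.IsTravelingWave W c u)
    (L : 𝓢'(ℝ, ℂ)) (hL : NonlocalGP.IsKernel W c L)
    (κ : ℝ → ℂ) (hκ : NonlocalGP.IsFunction L κ)
    (m : ℝ) (hm : 0 < m) (p : ℝ≥0∞) (hp : 1 < p)
    (hdecay : MemLp (fun x : ℝ => (Real.exp (m * |x|) : ℂ) * κ x) p) :
    ∃ v : ℝ → ℂ, ContDiff ℝ ∞ v ∧ u =ᵐ[volume] v ∧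
      ∀ ℓ : ℝ, 0 ≤ ℓ → ℓ < m → ∀ k : ℕ,
        Tendsto (fun x : ℝ => Real.exp (ℓ * |x|) * iteratedDeriv k (NonlocalGP.eta v) x)
          (cocompact ℝ) (𝓝 0) := by
  obtain ⟨v, g, huv, H⟩ := NonlocalGP.exists_isSmoothWave hW hu hsol
  refine ⟨v, contDiff_infty.2 fun n => (H.reg n).contDiff, huv, fun ℓ hℓ hℓm k => ?_⟩
  obtain ⟨a, h1, h2⟩ := exists_between hℓm
  -- The measurability of `κ` is part of the weighted bound, the weight being invertible.
  have hκm : AEStronglyMeasurable κ := by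
    have hc : Continuous fun x : ℝ => (Real.exp (-(m * |x|)) : ℂ) := by fun_prop
    refine (hc.aestronglyMeasurable.mul hdecay.1).congr (Eventually.of_forall fun x => ?_)
    simp only [Pi.mul_apply]
    rw [← mul_assoc, ← Complex.ofReal_mul, ← Real.exp_add, neg_add_cancel, Real.exp_zero,
      Complex.ofReal_one, one_mul]
  refine NonlocalGP.tendsto_exp_mul_of_expDecay h1
    (H.smoothBounded_eta.expDecay_iteratedDeriv (fun b hb hbm => ?_) k a (hℓ.trans h1.le) h2)
  exact H.expDecay_eta hW hL hκ hκm hb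
    (NonlocalGP.integrable_exp_mul_norm hp.le hbm hdecay)
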